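/- Let $\Omega\subset\mathbb R^2$ be a bounded domain (open and connected) with Lipschitz boundary. For $u=(u_1,u_2)\in [H^1(\Omega)]^2$ let $$\mathcal B u=(-\partial_x u_1+\partial_y u_2,\ \partial_y u_1+\partial_x u_2)\in[L^2(\Omega)]^2$$ (weak derivatives) be the Cauchy–Riemann operator. Let $H$ be a real Hilbert space continuously embedded into $[H^1(\Omega)]^2$, for example the fields with mean zero and inner product $\int_\Omega \partial u:\partial v\,dx$. Let $V=\{u\in H:\mathcal Bu=0\}$, so that $H=V\oplus V^\perp$, and write $w=w^{(1)}+w^{(2)}$ for the corresponding decomposition of $w\in H$. For $g\in[L^2(\partial\Omega)]^2$ write $\int_{\partial\Omega} g\cdot v\,ds$ for the integral over $\partial\Omega$ with respect to arc length, with $v$ replaced by its boundary trace. Then for every $g\in [L^2(\partial\Omega)]^2$ there is a unique $\varphi_g\in H$ with $(\varphi_g,v)_H=\int_{\partial\Omega}g\cdot v\,ds$ for all $v\in H$, and for every $\alpha>0$ the functional $$u\mapsto \tfrac12\left(\|\mathcal Bu\|_{[L^2(\Omega)]^2}^2+\alpha\|u\|_H^2\right)-\alpha\int_{\partial\Omega}g\cdot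 u\,ds$$ has a unique minimiser $u_\alpha$ over $H$. There is a constant $C>0$, independent of $\alpha$ and $g$, such that for every $g\in[L^2(\partial\Omega)]^2$: (i) $u_\alpha^{(1)}=\varphi_g^{(1)}$ for all $\alpha>0$. (ii) $\|u_\alpha^{(2)}\|_H\le\|\varphi_g^{(2)}\|_H\le C\|g\|_{[L^2(\partial\Omega)]^2}$ for all $\alpha>0$. (iii) For all $\alpha>0$ and all $v\in V^\perp$, $$(\mathcal Bu_\alpha^{(2)},\mathcal Bv)_{[L^2(\Omega)]^2}+\alpha(u_\alpha^{(2)},v)_H=\alpha\int_{\partial\Omega}g\cdot v\,ds.$$ (iv) As $\alpha\to0^+$, $u_\alpha\to\varphi_g^{(1)}$ strongly in $H$ and $\alpha^{-1/2}\,\mathcal Bu_\alpha\to0$ strongly in $[L^2(\Omega)]^2$. (v) As $\alpha\to\infty$, $u_\alpha\to\varphi_g$ strongly in $H$. -/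

import Mathlib

open MeasureTheory Filter Topology
open scoped ContDiff

noncomputable section

namespace NearlyHolomorphic

/-- The Euclidean plane. -/
abbrev Plane : Type := EuclideanSpace ℝ (Fin 2)

/-- The boundary of `Ω` is locally the graph of a Lipschitz function: near each boundary point,
after an orthogonal change of coordinates, `Ω` is the set of points above such a graph. -/
def HasLipschitzBoundary (Ω : Set Plane) : Prop :=
  ∀ x ∈ frontier Ω, ∃ (R : Plane ≃ₗᵢ[ℝ] Plane) (γ : ℝ → ℝ) (K : NNReal) (r : ℝ),
    0 < r ∧ LipschitzWith K γ ∧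
      ∀ y ∈ Metric.ball x r, y ∈ Ω ↔ γ (R y 0) < R y 1

/-- The real space `L²(Ω)` with Lebesgue measure. -/
abbrev L2 (Ω : Set Plane) : Type := Lp ℝ 2 (volume.restrict Ω)

/-- The space `[L²(Ω)]²`. -/
abbrev L2Vec (Ω : Set Plane) : Type := PiLp 2 (fun _ : Fin 2 => L2 Ω)

/-- The arc length measure on `∂Ω`, i.e. one-dimensional Hausdorff measure. -/
def arcLength (Ω : Set Plane) : Measure Plane := (μH[1]).restrict (frontier Ω)

/-- The space `L²(∂Ω)`. -/
abbrev L2Bdry (Ω : Set Plane) : Type := Lp ℝ 2 (arcLength Ω)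

/-- The space `[L²(∂Ω)]²`. -/
abbrev L2BdryVec (Ω : Set Plane) : Type := PiLp 2 (fun _ : Fin 2 => L2Bdry Ω)

/-- `p` is the weak partial derivative of `f` in the `i`-th coordinate direction on `Ω`. -/
def IsWeakPartial (Ω : Set Plane) (i : Fin 2) (f p : L2 Ω) : Prop :=
  ∀ ψ : Plane → ℝ, ContDiff ℝ ∞ ψ → HasCompactSupport ψ → tsupport ψ ⊆ Ω →
    ∫ x in Ω, f x * fderiv ℝ ψ x (EuclideanSpace.single i 1) = - ∫ x in Ω, p x * ψ x

/-- Test functions and their partial derivatives are square integrable. -/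
lemma memLp_test {Ω : Set Plane} {ψ : Plane → ℝ} (hψ : ContDiff ℝ ∞ ψ)
    (hc : HasCompactSupport ψ) :
    MemLp ψ 2 (volume.restrict Ω) ∧
      ∀ v : Plane, MemLp (fun x => fderiv ℝ ψ x v) 2 (volume.restrict Ω) := by
  refine ⟨(hψ.continuous.memLp_of_hasCompactSupport hc).restrict Ω, fun v => ?_⟩
  have h1 : Continuous (fun x => fderiv ℝ ψ x v) :=
    (hψ.continuous_fderiv (by simp)).clm_apply continuous_const
  exact (h1.memLp_of_hasCompactSupport (hc.fderiv_apply (𝕜 := ℝ) v)).restrict Ω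

/-- The Sobolev space `H¹(Ω)`. An element is a function in `L²(Ω)` together with its weak
gradient, which the function determines; the inherited inner product is
`(f, h)_{L²} + (∂₁f, ∂₁h)_{L²} + (∂₂f, ∂₂h)_{L²}`. -/
def H1 (Ω : Set Plane) : Submodule ℝ (WithLp 2 (L2 Ω × L2Vec Ω)) where
  carrier := {w | ∀ i : Fin 2, IsWeakPartial Ω i w.fst (w.snd i)}
  zero_mem' := by
    intro i ψ hψ hc hs
    have h0 : ∀ᵐ x ∂(volume.restrict Ω), (0 : L2 Ω) x = 0 := Lp.coeFn_zero ℝ 2 _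
    have h1 : ∫ x in Ω, (0 : L2 Ω) x * fderiv ℝ ψ x (EuclideanSpace.single i 1) = 0 :=
      integral_eq_zero_of_ae (by filter_upwards [h0] with x hx; rw [hx, zero_mul]; rfl)
    have h2 : ∫ x in Ω, (0 : L2 Ω) x * ψ x = 0 :=
      integral_eq_zero_of_ae (by filter_upwards [h0] with x hx; rw [hx, zero_mul]; rfl)
    change ∫ x in Ω, (0 : L2 Ω) x * fderiv ℝ ψ x (EuclideanSpace.single i 1)
      = - ∫ x in Ω, (0 : L2 Ω) x * ψ x
    rw [h1, h2, neg_zero]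
  add_mem' := by
    intro a b ha hb i ψ hψ hc hs
    obtain ⟨m0, m1⟩ := memLp_test (Ω := Ω) hψ hc
    have key : ∀ (f h : L2 Ω) (q : Plane → ℝ), MemLp q 2 (volume.restrict Ω) →
        ∫ x in Ω, (f + h : L2 Ω) x * q x = (∫ x in Ω, f x * q x) + ∫ x in Ω, h x * q x := by
      intro f h q hq
      have hf : Integrable (fun x => f x * q x) (volume.restrict Ω) :=
        (Lp.memLp f).integrable_mul hq
      have hh : Integrable (fun x => h x * q x) (volume.restrict Ω) :=
        (Lp.memLp h).integrable_mul hq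
      rw [← integral_add hf hh]
      refine integral_congr_ae ?_
      filter_upwards [Lp.coeFn_add f h] with x hx
      rw [hx, Pi.add_apply, add_mul]
    change ∫ x in Ω, (a.fst + b.fst : L2 Ω) x * fderiv ℝ ψ x (EuclideanSpace.single i 1)
      = - ∫ x in Ω, (a.snd i + b.snd i : L2 Ω) x * ψ x
    rw [key _ _ _ (m1 _), key _ _ _ m0, ha i ψ hψ hc hs, hb i ψ hψ hc hs, neg_add]
  smul_mem' := by
    intro c a ha i ψ hψ hc hs
    have key : ∀ (f : L2 Ω) (q : Plane → ℝ),
        ∫ x in Ω, (c • f : L2 Ω) x * q x = c * ∫ x in Ω, f x * q x := by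
      intro f q
      rw [← integral_const_mul]
      refine integral_congr_ae ?_
      filter_upwards [Lp.coeFn_smul c f] with x hx
      rw [hx, Pi.smul_apply, smul_eq_mul, mul_assoc]
    change ∫ x in Ω, (c • a.fst : L2 Ω) x * fderiv ℝ ψ x (EuclideanSpace.single i 1)
      = - ∫ x in Ω, (c • a.snd i : L2 Ω) x * ψ x
    rw [key, key, ha i ψ hψ hc hs, mul_neg]

/-- The space `[H¹(Ω)]²`. -/
abbrev H1Vec (Ω : Set Plane) : Type := PiLp 2 (fun _ : Fin 2 => H1 Ω)

/-- The weak partial derivative `∂ᵢ : H¹(Ω) → L²(Ω)`. -/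
def weakPartial (Ω : Set Plane) (i : Fin 2) : H1 Ω →L[ℝ] L2 Ω :=
  (PiLp.proj 2 (fun _ : Fin 2 => L2 Ω) i) ∘L (WithLp.sndL 2 ℝ (L2 Ω) (L2Vec Ω)) ∘L
    (H1 Ω).subtypeL

/-- The Cauchy–Riemann operator
`(u₁, u₂) ↦ (-∂₁u₁ + ∂₂u₂, ∂₂u₁ + ∂₁u₂)` from `[H¹(Ω)]²` to `[L²(Ω)]²`. -/
def crOp (Ω : Set Plane) : H1Vec Ω →L[ℝ] L2Vec Ω :=
  ((PiLp.continuousLinearEquiv 2 ℝ (fun _ : Fin 2 => L2 Ω)).symm :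
      (Fin 2 → L2 Ω) →L[ℝ] L2Vec Ω) ∘L
    ContinuousLinearMap.pi
      ![-(weakPartial Ω 0 ∘L PiLp.proj 2 (fun _ : Fin 2 => H1 Ω) 0)
          + weakPartial Ω 1 ∘L PiLp.proj 2 (fun _ : Fin 2 => H1 Ω) 1,
        weakPartial Ω 1 ∘L PiLp.proj 2 (fun _ : Fin 2 => H1 Ω) 0
          + weakPartial Ω 0 ∘L PiLp.proj 2 (fun _ : Fin 2 => H1 Ω) 1]

/-- The pairs `(φ|_Ω, φ|_∂Ω)` in `H¹(Ω) × L²(∂Ω)`, for `φ` smooth on the whole plane. -/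
def smoothTraceGraph (Ω : Set Plane) : Set (H1 Ω × L2Bdry Ω) :=
  {p | ∃ φ : Plane → ℝ, ContDiff ℝ ∞ φ ∧
    (p.1.1.fst : Plane → ℝ) =ᵐ[volume.restrict Ω] φ ∧
    (p.2 : Plane → ℝ) =ᵐ[arcLength Ω] φ}

/-- `t ∈ L²(∂Ω)` is the boundary trace of `w ∈ H¹(Ω)`: some functions that are smooth up to the
boundary converge to `w` in `H¹(Ω)` while their boundary values converge to `t` in `L²(∂Ω)`. -/
def IsTrace (Ω : Set Plane) (w : H1 Ω) (t : L2Bdry Ω) : Prop :=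
  (w, t) ∈ closure (smoothTraceGraph Ω)

/-- The trace operator `H¹(Ω) → L²(∂Ω)`: the boundary trace of `w` (for a bounded set with
Lipschitz boundary there is exactly one). -/
def trace (Ω : Set Plane) (w : H1 Ω) : L2Bdry Ω :=
  Classical.epsilon (IsTrace Ω w)

/-- The boundary functional `∫_∂Ω g · v ds`, where `v` stands for its trace on `∂Ω`. -/
def bdryFunctional (Ω : Set Plane) (g : L2BdryVec Ω) (v : H1Vec Ω) : ℝ :=
  ∫ x in frontier Ω, (∑ i : Fin 2, g i x * trace Ω (v i) x) ∂μH[1]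

variable {H : Type*} [NormedAddCommGroup H] [InnerProductSpace ℝ H]

/-- The space `V` of fields in `H` that satisfy the Cauchy–Riemann equations, where `H` is a space
of fields by means of the embedding `ι : H → [H¹(Ω)]²`. -/
def holoSubspace (Ω : Set Plane) (ι : H →L[ℝ] H1Vec Ω) : Submodule ℝ H :=
  LinearMap.ker (crOp Ω ∘L ι).toLinearMap

instance (Ω : Set Plane) (ι : H →L[ℝ] H1Vec Ω) [CompleteSpace H] :
    CompleteSpace (holoSubspace Ω ι) :=
  (crOp Ω ∘L ι).isClosed_ker.completeSpace_coe

/-- `φ` represents the boundary functional of `g` on `H`. -/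
def IsRieszRep (Ω : Set Plane) (ι : H →L[ℝ] H1Vec Ω) (g : L2BdryVec Ω) (φ : H) : Prop :=
  ∀ v : H, inner ℝ φ v = bdryFunctional Ω g (ι v)

/-- The penalised least-squares functional
`u ↦ ½ (‖𝓑u‖²_{L²} + α ‖u‖²_H) - α ∫_∂Ω g · u ds`, `𝓑` the Cauchy–Riemann operator. -/
def penalised (Ω : Set Plane) (ι : H →L[ℝ] H1Vec Ω) (g : L2BdryVec Ω) (α : ℝ) (u : H) : ℝ :=
  1 / 2 * (‖crOp Ω (ι u)‖ ^ 2 + α * ‖u‖ ^ 2) - α * bdryFunctional Ω g (ι u)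

/-- `u` minimises the penalised least-squares functional over `H`. -/
def IsMinimiser (Ω : Set Plane) (ι : H →L[ℝ] H1Vec Ω) (g : L2BdryVec Ω) (α : ℝ) (u : H) : Prop :=
  ∀ v : H, penalised Ω ι g α u ≤ penalised Ω ι g α v

end NearlyHolomorphic

end

open NearlyHolomorphic

/-!
The boundary functional `v ↦ ∫_∂Ω g · v ds` is bounded and linear on `[H¹(Ω)]²`; once this is known,
the statement is Tikhonov regularisation in a Hilbert space.

**Regularisation.** Let `A = 𝓑 ∘ ι` and let `φ` be the Riesz representative of the boundary
functional. The minimiser `u` of the penalised functional is the solution of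
`⟪A u, A v⟫ + α ⟪u, v⟫ = α ⟪φ, v⟫` for all `v` (`isTikhonovSolution_iff_minimises`), which exists by
the Lax–Milgram theorem. Testing with `v ∈ ker A` shows that `u` and `φ` have the same component in
`ker A`; the component orthogonal to `ker A` solves the same equation with the orthogonal component
of `φ` as datum, and testing with `v = u` bounds it. For large `α` one has `‖u - φ‖ = O(1 / α)`. For
small `α` the energy identity `α⁻¹ ‖A u‖² + ‖u‖² = ⟪φ, u⟫` and the density of the range of `A†` in
the complement of `ker A` force convergence (`IsTikhonovSolution.tendsto_zero`).

**The trace.** The trace operator is the closure of the restriction map on functions smooth on the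
whole plane. Two facts make it a bounded operator defined on all of `H¹(Ω)`
(`exists_clm_of_graph_bound`):
* the trace inequality `exists_trace_inequality`: near a boundary point, multiply `φ²` by a bump
  function, write its value on the graph as an integral of its vertical derivative over the line
  above the graph, and integrate over the base, arc length on a Lipschitz graph being at most a
  multiple of Lebesgue measure on the base;
* the density of smooth functions `exists_smooth_approx`: cut a function off by a finite partition of
  unity, and mollify each piece with kernels that look into `Ω` along a cone of directions, so that
  on `Ω` the mollification commutes with weak differentiation. The mollifications converge in `L²`
  because translation is continuous there.
-/

/-! ### Tikhonov regularisation in a Hilbert space -/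

section Tikhonov

variable {H E : Type*} [NormedAddCommGroup H] [InnerProductSpace ℝ H]
  [NormedAddCommGroup E] [InnerProductSpace ℝ E]

/-- `u` solves the normal equation `A†A u + α u = α φ`, in variational form. -/
def IsTikhonovSolution (A : H →L[ℝ] E) (φ : H) (α : ℝ) (u : H) : Prop :=
  ∀ v : H, inner ℝ (A u) (A v) + α * inner ℝ u v = α * inner ℝ φ v

lemma tikhonov_expand (A : H →L[ℝ] E) (φ : H) (α : ℝ) (u v : H) (t : ℝ) :
    1 / 2 * (‖A (u + t • v)‖ ^ 2 + α * ‖u + t • v‖ ^ 2) - α * inner ℝ φ (u + t • v)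
      = 1 / 2 * (‖A u‖ ^ 2 + α * ‖u‖ ^ 2) - α * inner ℝ φ u
        + ((1 / 2 * (‖A v‖ ^ 2 + α * ‖v‖ ^ 2)) * (t * t)
          + (inner ℝ (A u) (A v) + α * inner ℝ u v - α * inner ℝ φ v) * t) := by
  rw [map_add, map_smul, norm_add_sq_real, norm_add_sq_real, norm_smul, norm_smul,
    inner_smul_right, inner_smul_right, inner_add_right, inner_smul_right, mul_pow, mul_pow,
    Real.norm_eq_abs, sq_abs]
  ring

/-- Along each line `u + t • v` the functional is a quadratic polynomial in `t`, minimal at `0` exactly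
when its linear coefficient vanishes. -/
lemma isTikhonovSolution_iff_minimises (A : H →L[ℝ] E) (φ : H) {α : ℝ} (hα : 0 < α) (u : H) :
    (∀ v : H, 1 / 2 * (‖A u‖ ^ 2 + α * ‖u‖ ^ 2) - α * inner ℝ φ u
        ≤ 1 / 2 * (‖A v‖ ^ 2 + α * ‖v‖ ^ 2) - α * inner ℝ φ v) ↔ IsTikhonovSolution A φ α u := by
  constructor
  · intro h v
    have h1 := discrim_le_zero (K := ℝ) (a := 1 / 2 * (‖A v‖ ^ 2 + α * ‖v‖ ^ 2))
      (b := inner ℝ (A u) (A v) + α * inner ℝ u v - α * inner ℝ φ v) (c := 0) (fun t => by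
        have := h (u + t • v)
        rw [tikhonov_expand] at this
        linarith)
    rw [discrim, mul_zero, sub_zero] at h1
    have := pow_eq_zero_iff (two_ne_zero) |>.1 (le_antisymm h1 (sq_nonneg _))
    linarith
  · intro h v
    have h1 := tikhonov_expand A φ α u (v - u) 1
    rw [one_smul, add_sub_cancel, h (v - u)] at h1
    rw [h1]
    have : 0 ≤ 1 / 2 * (‖A (v - u)‖ ^ 2 + α * ‖v - u‖ ^ 2) := by positivity
    linarith

lemma IsTikhonovSolution.unique {A : H →L[ℝ] E} {φ : H} {α : ℝ} (hα : 0 < α) {u w : H}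
    (hu : IsTikhonovSolution A φ α u) (hw : IsTikhonovSolution A φ α w) : u = w := by
  have h1 := hu (u - w)
  have h2 := hw (u - w)
  have h3 : ‖A (u - w)‖ ^ 2 + α * ‖u - w‖ ^ 2 = 0 := by
    have h4 : inner ℝ (A u) (A (u - w)) - inner ℝ (A w) (A (u - w)) = ‖A (u - w)‖ ^ 2 := by
      rw [← inner_sub_left, ← map_sub, real_inner_self_eq_norm_sq]
    have h5 : inner ℝ u (u - w) - inner ℝ w (u - w) = ‖u - w‖ ^ 2 := by
      rw [← inner_sub_left, real_inner_self_eq_norm_sq]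
    rw [← h4, ← h5]
    linarith
  have h4 : α * ‖u - w‖ ^ 2 = 0 := by
    have : 0 ≤ α * ‖u - w‖ ^ 2 := by positivity
    nlinarith [sq_nonneg ‖A (u - w)‖]
  have h5 : ‖u - w‖ = 0 := by
    rcases mul_eq_zero.1 h4 with h | h
    · exact absurd h hα.ne'
    · exact pow_eq_zero_iff two_ne_zero |>.1 h
  exact sub_eq_zero.1 (norm_eq_zero.1 h5)

lemma exists_isTikhonovSolution [CompleteSpace H] (A : H →L[ℝ] E) (φ : H) {α : ℝ} (hα : 0 < α) :
    ∃ u, IsTikhonovSolution A φ α u := by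
  set B : H →L[ℝ] H →L[ℝ] ℝ :=
    ((innerSL ℝ : E →L[ℝ] E →L[ℝ] ℝ).bilinearComp A A) + α • (innerSL ℝ : H →L[ℝ] H →L[ℝ] ℝ)
  have hB : ∀ u v, B u v = inner ℝ (A u) (A v) + α * inner ℝ u v := fun u v => rfl
  have hc : IsCoercive B := by
    refine ⟨α, hα, fun u => ?_⟩
    rw [hB, real_inner_self_eq_norm_sq, real_inner_self_eq_norm_sq]
    nlinarith [sq_nonneg ‖A u‖]
  refine ⟨hc.continuousLinearEquivOfBilin.symm (α • φ), fun v => ?_⟩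
  rw [← hB, ← hc.continuousLinearEquivOfBilin_apply]
  rw [ContinuousLinearEquiv.apply_symm_apply, real_inner_smul_left]

namespace IsTikhonovSolution

variable {A : H →L[ℝ] E} {φ : H} {α : ℝ} {u : H}

lemma norm_le (h : IsTikhonovSolution A φ α u) (hα : 0 < α) : ‖u‖ ≤ ‖φ‖ := by
  have h1 := h u
  rw [real_inner_self_eq_norm_sq, real_inner_self_eq_norm_sq] at h1
  have h2 : α * ‖u‖ ^ 2 ≤ α * (‖φ‖ * ‖u‖) := by
    have := mul_le_mul_of_nonneg_left (real_inner_le_norm φ u) hα.le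
    nlinarith [sq_nonneg ‖A u‖]
  have h3 : ‖u‖ ^ 2 ≤ ‖φ‖ * ‖u‖ := le_of_mul_le_mul_left h2 hα
  by_contra! h4
  nlinarith [norm_nonneg φ]

lemma norm_sub_le (h : IsTikhonovSolution A φ α u) (hα : 0 < α) :
    ‖u - φ‖ ≤ ‖A‖ ^ 2 * ‖φ‖ / α := by
  have h1 := h (u - φ)
  have h5 : inner ℝ u (u - φ) - inner ℝ φ (u - φ) = ‖u - φ‖ ^ 2 := by
    rw [← inner_sub_left, real_inner_self_eq_norm_sq]
  have h2 : α * ‖u - φ‖ ^ 2 ≤ ‖A u‖ * ‖A (u - φ)‖ := by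
    have := neg_le_of_abs_le (abs_real_inner_le_norm (A u) (A (u - φ)))
    rw [← h5]
    linarith
  have h3 : ‖A u‖ * ‖A (u - φ)‖ ≤ (‖A‖ * ‖φ‖) * (‖A‖ * ‖u - φ‖) := by
    gcongr
    · exact (A.le_opNorm u).trans (by gcongr; exact h.norm_le hα)
    · exact A.le_opNorm _
  rw [le_div_iff₀ hα]
  by_contra! h4
  have h6 : 0 < ‖u - φ‖ := by
    by_contra! h7
    have h8 : ‖u - φ‖ = 0 := le_antisymm h7 (norm_nonneg _)
    rw [h8, zero_mul] at h4
    exact absurd h4 (not_lt.2 (by positivity))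
  nlinarith

/-- The component in `ker A` does not feel the penalty. -/
lemma starProjection_ker_eq [(LinearMap.ker A.toLinearMap).HasOrthogonalProjection]
    (h : IsTikhonovSolution A φ α u) (hα : 0 < α) :
    (LinearMap.ker A.toLinearMap).starProjection u
      = (LinearMap.ker A.toLinearMap).starProjection φ := by
  rw [← sub_eq_zero, ← map_sub, Submodule.starProjection_apply_eq_zero_iff]
  intro v hv
  have h1 := h v
  have h2 : A v = 0 := hv
  rw [h2, inner_zero_right, zero_add] at h1
  rw [inner_sub_right, real_inner_comm, real_inner_comm φ v, mul_left_cancel₀ hα.ne' h1, sub_self]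

/-- The component orthogonal to `ker A` solves the problem whose datum is the component of the
datum orthogonal to `ker A`. -/
lemma starProjection_orthogonal [(LinearMap.ker A.toLinearMap).HasOrthogonalProjection]
    (h : IsTikhonovSolution A φ α u) (hα : 0 < α) :
    IsTikhonovSolution A ((LinearMap.ker A.toLinearMap)ᗮ.starProjection φ) α
      ((LinearMap.ker A.toLinearMap)ᗮ.starProjection u) := by
  intro v
  have h1 := h v
  have h2 := h.starProjection_ker_eq hα
  have h3 : A ((LinearMap.ker A.toLinearMap).starProjection u) = 0 :=
    Submodule.starProjection_apply_mem (LinearMap.ker A.toLinearMap) u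
  rw [Submodule.starProjection_orthogonal_val, Submodule.starProjection_orthogonal_val, map_sub,
    h3, sub_zero, inner_sub_left, inner_sub_left, h2, mul_sub, mul_sub]
  linarith

/-- As the penalty parameter vanishes, solutions whose datum is orthogonal to `ker A` tend to `0`,
and the residual `A u` is `o(√α)`. Both follow from `α⁻¹ ‖A u‖² + ‖u‖² = ⟪φ, u⟫` once the right
side tends to `0`, and it does because `φ` is approximated by `A† ψ`, with
`⟪A† ψ, u⟫ = ⟪ψ, A u⟫ = O(√α)`. -/
lemma tendsto_zero [CompleteSpace H] [CompleteSpace E] {u : ℝ → H}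
    (hφ : φ ∈ (LinearMap.ker A.toLinearMap)ᗮ)
    (h : ∀ α, 0 < α → IsTikhonovSolution A φ α (u α)) :
    Tendsto u (𝓝[>] 0) (𝓝 0) ∧
      Tendsto (fun α : ℝ => (1 / Real.sqrt α) • A (u α)) (𝓝[>] 0) (𝓝 0) := by
  have energy : ∀ α, 0 < α → ‖(1 / Real.sqrt α) • A (u α)‖ ^ 2 + ‖u α‖ ^ 2 = inner ℝ φ (u α) := by
    intro α hα
    have h1 := h α hα (u α)
    rw [real_inner_self_eq_norm_sq, real_inner_self_eq_norm_sq] at h1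
    rw [norm_smul, mul_pow, Real.norm_eq_abs, sq_abs, div_pow, Real.sq_sqrt hα.le]
    field_simp
    linarith
  have residual : ∀ α, 0 < α → ‖A (u α)‖ ≤ Real.sqrt α * ‖φ‖ := by
    intro α hα
    have h1 := energy α hα
    have h2 : ‖(1 / Real.sqrt α) • A (u α)‖ ^ 2 ≤ ‖φ‖ ^ 2 := by
      have := real_inner_le_norm φ (u α)
      have h3 := (h α hα).norm_le hα
      nlinarith [norm_nonneg (u α), norm_nonneg φ, sq_nonneg ‖u α‖]
    have h4 := abs_le_of_sq_le_sq h2 (norm_nonneg _)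
    have h5 : 0 < Real.sqrt α := Real.sqrt_pos.2 hα
    rw [norm_smul, abs_mul, abs_norm, abs_norm, Real.norm_eq_abs, abs_of_pos (by positivity), one_div,
      inv_mul_le_iff₀ h5] at h4
    exact h4
  have key : Tendsto (fun α => inner ℝ φ (u α)) (𝓝[>] 0) (𝓝 0) := by
    rw [Metric.tendsto_nhds]
    intro ε hε
    have hcl : φ ∈ closure (Set.range (ContinuousLinearMap.adjoint A)) := by
      have h1 : (LinearMap.ker A.toLinearMap)ᗮ
          = (LinearMap.range (ContinuousLinearMap.adjoint A).toLinearMap).topologicalClosure :=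
        ContinuousLinearMap.orthogonal_ker A
      rw [h1] at hφ
      exact hφ
    obtain ⟨_, ⟨ψ, rfl⟩, hψ⟩ := Metric.mem_closure_iff.1 hcl (ε / (2 * (‖φ‖ + 1))) (by positivity)
    have hlim : Tendsto (fun α : ℝ => ‖ψ‖ * (Real.sqrt α * ‖φ‖)) (𝓝[>] 0) (𝓝 0) := by
      have : Tendsto (fun α : ℝ => ‖ψ‖ * (Real.sqrt α * ‖φ‖)) (𝓝 0)
          (𝓝 (‖ψ‖ * (Real.sqrt 0 * ‖φ‖))) := by
        apply Continuous.tendsto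
        fun_prop
      rw [Real.sqrt_zero, zero_mul, mul_zero] at this
      exact this.mono_left nhdsWithin_le_nhds
    filter_upwards [hlim.eventually_lt_const (half_pos hε), self_mem_nhdsWithin] with α h1 hα
    have hα : 0 < α := hα
    rw [dist_zero_right, Real.norm_eq_abs]
    have h2 : inner ℝ φ (u α) = inner ℝ (φ - ContinuousLinearMap.adjoint A ψ) (u α)
        + inner ℝ ψ (A (u α)) := by
      rw [inner_sub_left, ContinuousLinearMap.adjoint_inner_left]
      ring
    rw [h2]
    have h3 := abs_real_inner_le_norm (φ - ContinuousLinearMap.adjoint A ψ) (u α)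
    have h4 := abs_real_inner_le_norm ψ (A (u α))
    have h5 : ‖φ - ContinuousLinearMap.adjoint A ψ‖ * ‖u α‖
        ≤ ε / (2 * (‖φ‖ + 1)) * (‖φ‖ + 1) := by
      gcongr
      · rw [← dist_eq_norm]; exact hψ.le
      · linarith [(h α hα).norm_le hα]
    have h6 : ε / (2 * (‖φ‖ + 1)) * (‖φ‖ + 1) = ε / 2 := by field_simp
    have h7 : ‖ψ‖ * ‖A (u α)‖ ≤ ‖ψ‖ * (Real.sqrt α * ‖φ‖) := by
      gcongr
      exact residual α hα
    linarith [abs_add_le (inner ℝ (φ - ContinuousLinearMap.adjoint A ψ) (u α))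
      (inner ℝ ψ (A (u α)))]
  have key' : Tendsto (fun α => Real.sqrt (inner ℝ φ (u α))) (𝓝[>] 0) (𝓝 0) := by
    have h1 := (Real.continuous_sqrt.tendsto 0).comp key
    rwa [Real.sqrt_zero] at h1
  constructor
  · refine squeeze_zero_norm' ?_ key'
    filter_upwards [self_mem_nhdsWithin] with α hα
    refine Real.le_sqrt_of_sq_le ?_
    rw [← energy α hα]
    exact le_add_of_nonneg_left (sq_nonneg _)
  · refine squeeze_zero_norm' ?_ key'
    filter_upwards [self_mem_nhdsWithin] with α hα
    refine Real.le_sqrt_of_sq_le ?_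
    rw [← energy α hα]
    exact le_add_of_nonneg_right (sq_nonneg _)

end IsTikhonovSolution

end Tikhonov

/-! ### Mollification in `L²` -/

section Mollification

open scoped Convolution ENNReal

lemma eLpNorm_two_sq {X : Type*} [MeasurableSpace X] (μ : Measure X) (f : X → ℝ) :
    eLpNorm f 2 μ ^ 2 = ∫⁻ x, ‖f x‖ₑ ^ 2 ∂μ := by
  have h := eLpNorm_nnreal_pow_eq_lintegral (μ := μ) (f := f) (p := 2) two_ne_zero
  have h2 : ((2 : NNReal) : ℝ) = ((2 : ℕ) : ℝ) := by norm_num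
  rw [h2] at h
  simp_rw [ENNReal.rpow_natCast] at h
  exact h

variable {G : Type*} [NormedAddCommGroup G] [NormedSpace ℝ G] [FiniteDimensional ℝ G]
  [MeasurableSpace G] [BorelSpace G] {μ : Measure G} [μ.IsAddHaarMeasure]

/-- Translation is continuous in `L²`. -/
lemma exists_eLpNorm_translate_sub_le {f : G → ℝ} (hf : MemLp f 2 μ) {ε : ℝ≥0∞} (hε : 0 < ε) :
    ∃ ρ > 0, ∀ z : G, ‖z‖ < ρ → eLpNorm (fun x => f (x - z) - f x) 2 μ ≤ ε := by
  let g : C(G, C(G, G)) := (ContinuousMap.mk (fun p : G × G => p.2 - p.1) (by fun_prop)).curry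
  have hg : ∀ z, MeasurePreserving (g z) μ μ := fun z => measurePreserving_sub_right μ z
  have hc : Continuous fun z => Lp.compMeasurePreserving (g z) (hg z) (hf.toLp f) :=
    (continuous_const).compMeasurePreservingLp g.continuous hg (by simp)
  have h0 := EMetric.tendsto_nhds.1 (hc.tendsto 0) ε hε
  obtain ⟨ρ, hρ, h⟩ := Metric.eventually_nhds_iff.1 h0
  refine ⟨ρ, hρ, fun z hz => ?_⟩
  have h1 := (h (y := z) (by simpa using hz)).le
  rw [Lp.edist_def] at h1
  refine le_trans (le_of_eq (eLpNorm_congr_ae ?_)) h1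
  have e1 : ∀ z, Lp.compMeasurePreserving (g z) (hg z) (hf.toLp f) =ᵐ[μ] fun x => f (x - z) := by
    intro z
    refine (Lp.coeFn_compMeasurePreserving _ (hg z)).trans ?_
    exact (hg z).quasiMeasurePreserving.ae_eq_comp hf.coeFn_toLp
  filter_upwards [e1 z, e1 0] with x hx h0
  rw [Pi.sub_apply, hx, h0, sub_zero]

/-- An average of translates of `f` is as close to `f` in `L²` as the translates are. -/
lemma eLpNorm_convolution_sub_le {f k : G → ℝ} (hfm : Measurable f) (hf : MemLp f 2 μ)
    (hk : Continuous k) (hkc : HasCompactSupport k) (hk0 : ∀ z, 0 ≤ k z) (hk1 : ∫ z, k z ∂μ = 1)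
    {ε : ℝ≥0∞} (h : ∀ z ∈ Function.support k, eLpNorm (fun x => f (x - z) - f x) 2 μ ≤ ε) :
    eLpNorm (fun x => (k ⋆[ContinuousLinearMap.mul ℝ ℝ, μ] f) x - f x) 2 μ ≤ ε := by
  set ν := μ.withDensity (fun z => ENNReal.ofReal (k z)) with hν
  have hki : Integrable k μ := hk.integrable_of_hasCompactSupport hkc
  have hkm : Measurable fun z => ENNReal.ofReal (k z) := hk.measurable.ennreal_ofReal
  have hprob : IsProbabilityMeasure ν := by
    refine ⟨?_⟩
    rw [hν, withDensity_apply _ MeasurableSet.univ, setLIntegral_univ,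
      ← ofReal_integral_eq_lintegral_ofReal hki (Eventually.of_forall hk0), hk1, ENNReal.ofReal_one]
  have hloc : LocallyIntegrable f μ := hf.locallyIntegrable (by norm_num)
  have hm2 : Measurable fun p : G × G => f (p.1 - p.2) - f p.1 := by fun_prop
  have hpt : ∀ x, ‖(k ⋆[ContinuousLinearMap.mul ℝ ℝ, μ] f) x - f x‖ₑ ^ 2
      ≤ ∫⁻ z, ‖f (x - z) - f x‖ₑ ^ 2 ∂ν := by
    intro x
    have h1 : Integrable (fun z => k z * f (x - z)) μ :=
      hkc.convolutionExists_left (ContinuousLinearMap.mul ℝ ℝ) hk hloc x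
    have h2 : (k ⋆[ContinuousLinearMap.mul ℝ ℝ, μ] f) x - f x
        = ∫ z, k z * (f (x - z) - f x) ∂μ := by
      simp_rw [mul_sub]
      rw [integral_sub h1 (hki.mul_const _), integral_mul_const, hk1, one_mul]
      rfl
    have h3 : ‖(k ⋆[ContinuousLinearMap.mul ℝ ℝ, μ] f) x - f x‖ₑ
        ≤ ∫⁻ z, ‖f (x - z) - f x‖ₑ ∂ν := by
      rw [h2, hν, lintegral_withDensity_eq_lintegral_mul _ hkm (by fun_prop)]
      refine (enorm_integral_le_lintegral_enorm _).trans (le_of_eq ?_)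
      refine lintegral_congr fun z => ?_
      rw [enorm_mul, Pi.mul_apply, Real.enorm_of_nonneg (hk0 z)]
    have h4 := eLpNorm_le_eLpNorm_of_exponent_le (μ := ν) (p := 1) (q := 2) (by norm_num)
      (f := fun z => f (x - z) - f x) (by fun_prop : Measurable _).aestronglyMeasurable
    rw [eLpNorm_one_eq_lintegral_enorm] at h4
    rw [← eLpNorm_two_sq]
    exact pow_le_pow_left' (h3.trans h4) 2
  have hsq : eLpNorm (fun x => (k ⋆[ContinuousLinearMap.mul ℝ ℝ, μ] f) x - f x) 2 μ ^ 2
      ≤ ε ^ 2 := by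
    rw [eLpNorm_two_sq]
    calc _ ≤ ∫⁻ x, ∫⁻ z, ‖f (x - z) - f x‖ₑ ^ 2 ∂ν ∂μ := lintegral_mono hpt
      _ = ∫⁻ z, ∫⁻ x, ‖f (x - z) - f x‖ₑ ^ 2 ∂μ ∂ν :=
          lintegral_lintegral_swap (hm2.enorm.pow_const 2).aemeasurable
      _ = ∫⁻ z, ENNReal.ofReal (k z) * ∫⁻ x, ‖f (x - z) - f x‖ₑ ^ 2 ∂μ ∂μ := by
          rw [hν, lintegral_withDensity_eq_lintegral_mul _ hkm]
          · rfl
          · exact Measurable.lintegral_prod_left' (hm2.enorm.pow_const 2)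
      _ ≤ ∫⁻ z, ENNReal.ofReal (k z) * ε ^ 2 ∂μ := by
          refine lintegral_mono fun z => ?_
          by_cases hz : k z = 0
          · simp [hz]
          · rw [← eLpNorm_two_sq]
            gcongr
            exact h z hz
      _ = ε ^ 2 := by
          rw [lintegral_mul_const _ hkm,
            ← ofReal_integral_eq_lintegral_ofReal hki (Eventually.of_forall hk0), hk1,
            ENNReal.ofReal_one, one_mul]
  exact (ENNReal.pow_le_pow_left_iff two_ne_zero).1 hsq

end Mollification

/-! ### Charts of the boundary -/

section Chart

/-- The inverse of the rotated coordinates `x ↦ (R x 0, R x 1)`. -/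
noncomputable def chartMap (R : Plane ≃ₗᵢ[ℝ] Plane) (p : ℝ × ℝ) : Plane := R.symm !₂[p.1, p.2]

lemma chartMap_eq (R : Plane ≃ₗᵢ[ℝ] Plane) (t y : ℝ) :
    chartMap R (t, y) = t • R.symm (EuclideanSpace.single 0 1)
      + y • R.symm (EuclideanSpace.single 1 1) := by
  rw [chartMap, ← map_smul, ← map_smul, ← map_add]
  congr 1
  ext i
  fin_cases i <;> simp

lemma chartMap_zero_coord (R : Plane ≃ₗᵢ[ℝ] Plane) (p : ℝ × ℝ) : R (chartMap R p) 0 = p.1 := by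
  simp [chartMap]

lemma chartMap_one_coord (R : Plane ≃ₗᵢ[ℝ] Plane) (p : ℝ × ℝ) : R (chartMap R p) 1 = p.2 := by
  simp [chartMap]

lemma chartMap_coord (R : Plane ≃ₗᵢ[ℝ] Plane) (x : Plane) : chartMap R (R x 0, R x 1) = x := by
  rw [chartMap, LinearIsometryEquiv.symm_apply_eq]
  ext i
  fin_cases i <;> simp

lemma continuous_chartMap (R : Plane ≃ₗᵢ[ℝ] Plane) : Continuous (chartMap R) := by
  have : chartMap R = fun p : ℝ × ℝ => p.1 • R.symm (EuclideanSpace.single 0 1)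
      + p.2 • R.symm (EuclideanSpace.single 1 1) := funext fun p => chartMap_eq R p.1 p.2
  rw [this]
  fun_prop

lemma measurePreserving_chartMap (R : Plane ≃ₗᵢ[ℝ] Plane) :
    MeasurePreserving (chartMap R) := by
  have h1 := (volume_preserving_finTwoArrow ℝ).symm
  have h2 := PiLp.volume_preserving_toLp (Fin 2)
  have h3 := R.symm.measurePreserving
  have h := h3.comp (h2.comp h1)
  have h4 : chartMap R = R.symm ∘ WithLp.toLp 2 ∘ MeasurableEquiv.finTwoArrow.symm := by
    ext p : 1
    rw [chartMap, Function.comp_apply, Function.comp_apply]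
    congr 2
  rw [h4]
  exact h

lemma lipschitzWith_chartMap_graph (R : Plane ≃ₗᵢ[ℝ] Plane) {γ : ℝ → ℝ} {K : NNReal}
    (hγ : LipschitzWith K γ) : LipschitzWith (1 + K) (fun t => chartMap R (t, γ t)) := by
  refine LipschitzWith.of_dist_le_mul fun s t => ?_
  have h1 := hγ.dist_le_mul s t
  rw [Real.dist_eq, Real.dist_eq] at h1
  rw [dist_eq_norm, chartMap_eq, chartMap_eq, add_sub_add_comm, ← sub_smul, ← sub_smul]
  refine (norm_add_le _ _).trans ?_
  rw [norm_smul, norm_smul, LinearIsometryEquiv.norm_map, LinearIsometryEquiv.norm_map,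
    PiLp.norm_single, PiLp.norm_single, norm_one, mul_one, mul_one,
    Real.norm_eq_abs, Real.norm_eq_abs, Real.dist_eq]
  push_cast
  linarith

/-- Near a boundary point, the boundary lies on the graph of the chart. -/
lemma frontier_inter_ball_subset_graph {Ω : Set Plane} (hΩo : IsOpen Ω) {R : Plane ≃ₗᵢ[ℝ] Plane}
    {γ : ℝ → ℝ} (hγ : Continuous γ) {x : Plane} {r : ℝ}
    (h : ∀ y ∈ Metric.ball x r, y ∈ Ω ↔ γ (R y 0) < R y 1) :
    frontier Ω ∩ Metric.ball x r ⊆ Set.range fun t => chartMap R (t, γ t) := by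
  rintro y ⟨hy, hyr⟩
  rw [hΩo.frontier_eq] at hy
  have h1 : R y 1 ≤ γ (R y 0) := not_lt.1 fun h' => hy.2 ((h y hyr).2 h')
  have h2 : γ (R y 0) ≤ R y 1 := by
    by_contra! h'
    have hopen : IsOpen {z : Plane | R z 1 < γ (R z 0)} :=
      isOpen_lt (by fun_prop) (by fun_prop)
    obtain ⟨z, ⟨hz1, hz2⟩, hz3⟩ := mem_closure_iff.1 hy.1 _
      (hopen.inter Metric.isOpen_ball) ⟨h', hyr⟩
    exact lt_asymm hz1 ((h z hz2).1 hz3)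
  refine ⟨R y 0, ?_⟩
  change chartMap R (R y 0, γ (R y 0)) = y
  rw [← le_antisymm h1 h2, chartMap_coord]

/-- Arc length on a Lipschitz graph is controlled by Lebesgue measure on the parameter line. -/
lemma lintegral_hausdorffMeasure_graph_le (R : Plane ≃ₗᵢ[ℝ] Plane) {γ : ℝ → ℝ} {K : NNReal}
    (hγ : LipschitzWith K γ) {T : Set Plane} (hT : T ⊆ Set.range fun t => chartMap R (t, γ t))
    {F : Plane → ENNReal} (hF : Measurable F) :
    ∫⁻ x in T, F x ∂μH[1] ≤ (1 + K : NNReal) * ∫⁻ t, F (chartMap R (t, γ t)) := by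
  have hL := lipschitzWith_chartMap_graph R hγ
  have hm : Measurable fun t => chartMap R (t, γ t) := hL.continuous.measurable
  have h1 : (μH[1] : Measure Plane).restrict T
      ≤ (1 + K : NNReal) • Measure.map (fun t => chartMap R (t, γ t)) volume := by
    refine Measure.le_iff.2 fun A hA => ?_
    rw [Measure.restrict_apply hA, Measure.smul_apply, Measure.map_apply hm hA]
    have h2 : A ∩ T ⊆ (fun t => chartMap R (t, γ t)) '' ((fun t => chartMap R (t, γ t)) ⁻¹' A) := by
      rintro x ⟨hx, hxT⟩
      obtain ⟨t, rfl⟩ := hT hxT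
      exact ⟨t, hx, rfl⟩
    refine (measure_mono h2).trans ((hL.hausdorffMeasure_image_le zero_le_one _).trans ?_)
    rw [hausdorffMeasure_real, ENNReal.rpow_one]
    rfl
  refine (lintegral_mono' h1 le_rfl).trans (le_of_eq ?_)
  rw [lintegral_smul_measure, lintegral_map hF hm]
  rfl

/-- Integrating the vertical derivative over the lines above the graph. -/
lemma lintegral_graph_le (R : Plane ≃ₗᵢ[ℝ] Plane) {γ : ℝ → ℝ} (hγ : Continuous γ) {F : Plane → ℝ}
    (hF : ContDiff ℝ 1 F) (hFc : HasCompactSupport F) :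
    ∫⁻ t, ‖F (chartMap R (t, γ t))‖ₑ
      ≤ ∫⁻ x in {x | γ (R x 0) < R x 1},
          ‖fderiv ℝ F x (R.symm (EuclideanSpace.single 1 1))‖ₑ := by
  set b : Plane := R.symm (EuclideanSpace.single 1 1) with hb
  have hbn : ‖b‖ = 1 := by simp [hb]
  set D : Plane → ENNReal := fun x => ‖fderiv ℝ F x b‖ₑ with hD
  have hDm : Measurable D :=
    ((hF.continuous_fderiv one_ne_zero).clm_apply continuous_const).measurable.enorm
  have hline : ∀ t, ‖F (chartMap R (t, γ t))‖ₑ ≤ ∫⁻ y in Set.Ioi (γ t), D (chartMap R (t, y)) := by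
    intro t
    set c : ℝ → Plane := fun y => chartMap R (t, y) with hc
    have hc' : c = fun y => t • R.symm (EuclideanSpace.single 0 1) + y • b :=
      funext fun y => chartMap_eq R t y
    have hcd : ContDiff ℝ 1 c := by rw [hc']; fun_prop
    have hder : ∀ y, HasDerivAt c b y := by
      intro y
      rw [hc']
      simpa using ((hasDerivAt_id y).smul_const b).const_add (t • R.symm (EuclideanSpace.single 0 1))
    have hiso : Isometry c := by
      refine Isometry.of_dist_eq fun y z => ?_
      rw [hc', dist_add_left, dist_eq_norm, ← sub_smul, norm_smul, hbn, mul_one, Real.dist_eq,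
        Real.norm_eq_abs]
    have hcs : HasCompactSupport (F ∘ c) := hFc.comp_isClosedEmbedding hiso.isClosedEmbedding
    have hftc := hcs.integral_Ioi_deriv_eq (hF.comp hcd) (γ t)
    have hderiv : ∀ y, deriv (F ∘ c) y = fderiv ℝ F (c y) b := fun y =>
      (((hF.differentiable one_ne_zero).differentiableAt.hasFDerivAt).comp_hasDerivAt y
        (hder y)).deriv
    calc ‖F (chartMap R (t, γ t))‖ₑ = ‖∫ y in Set.Ioi (γ t), deriv (F ∘ c) y‖ₑ := by
          rw [hftc, enorm_neg]; rfl
      _ ≤ ∫⁻ y in Set.Ioi (γ t), ‖deriv (F ∘ c) y‖ₑ := enorm_integral_le_lintegral_enorm _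
      _ = _ := lintegral_congr fun y => by rw [hderiv y]
  have hS : MeasurableSet {x : Plane | γ (R x 0) < R x 1} :=
    measurableSet_lt (by fun_prop) (by fun_prop)
  set I : Plane → ENNReal := {x : Plane | γ (R x 0) < R x 1}.indicator D with hI
  have hIm : Measurable I := hDm.indicator hS
  calc _ ≤ ∫⁻ t, ∫⁻ y, I (chartMap R (t, y)) := by
        refine lintegral_mono fun t => (hline t).trans (le_of_eq ?_)
        rw [← lintegral_indicator measurableSet_Ioi]
        refine lintegral_congr fun y => ?_
        have : y ∈ Set.Ioi (γ t) ↔ chartMap R (t, y) ∈ {x : Plane | γ (R x 0) < R x 1} := by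
          simp [chartMap_zero_coord, chartMap_one_coord]
        by_cases hy : y ∈ Set.Ioi (γ t)
        · rw [Set.indicator_of_mem hy, hI, Set.indicator_of_mem (this.1 hy)]
        · rw [Set.indicator_of_notMem hy, hI, Set.indicator_of_notMem (fun h => hy (this.2 h))]
    _ = ∫⁻ p : ℝ × ℝ, I (chartMap R p) := by
        rw [Measure.volume_eq_prod]
        exact (lintegral_prod (fun p => I (chartMap R p))
          (hIm.comp (continuous_chartMap R).measurable).aemeasurable).symm
    _ = ∫⁻ x, I x := (measurePreserving_chartMap R).lintegral_comp hIm
    _ = _ := lintegral_indicator hS _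

end Chart

/-! ### The trace inequality -/

section TraceInequality

/-- The density of the squared `H¹` norm of a smooth function. -/
noncomputable def energyDensity (φ : Plane → ℝ) (x : Plane) : ℝ := φ x ^ 2 + ‖fderiv ℝ φ x‖ ^ 2

lemma fderiv_mul_sq_le {η φ : Plane → ℝ} (hη : Differentiable ℝ η) (hφ : Differentiable ℝ φ)
    (x b : Plane) (hb : ‖b‖ = 1) :
    |fderiv ℝ (fun x => η x * φ x ^ 2) x b| ≤ (|η x| + ‖fderiv ℝ η x‖) * energyDensity φ x := by
  have h1 : fderiv ℝ (fun x => η x * φ x ^ 2) x b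
      = φ x ^ 2 * fderiv ℝ η x b + η x * (2 * φ x * fderiv ℝ φ x b) := by
    have h : HasFDerivAt (fun x => η x * φ x ^ 2) _ x :=
      (hη x).hasFDerivAt.mul ((hφ x).hasFDerivAt.pow 2)
    rw [h.fderiv]
    simp
    ring
  have h2 : |fderiv ℝ η x b| ≤ ‖fderiv ℝ η x‖ := by
    simpa [hb] using (fderiv ℝ η x).le_opNorm b
  have h3 : |fderiv ℝ φ x b| ≤ ‖fderiv ℝ φ x‖ := by
    simpa [hb] using (fderiv ℝ φ x).le_opNorm b
  have h4 : 2 * |φ x| * |fderiv ℝ φ x b| ≤ energyDensity φ x := by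
    unfold energyDensity
    nlinarith [two_mul_le_add_sq |φ x| |fderiv ℝ φ x b|, sq_abs (φ x),
      pow_le_pow_left₀ (abs_nonneg _) h3 2]
  have h5 : φ x ^ 2 ≤ energyDensity φ x := le_add_of_nonneg_right (sq_nonneg _)
  rw [h1]
  calc _ ≤ |φ x ^ 2 * fderiv ℝ η x b| + |η x * (2 * φ x * fderiv ℝ φ x b)| := abs_add_le _ _
    _ = φ x ^ 2 * |fderiv ℝ η x b| + |η x| * (2 * |φ x| * |fderiv ℝ φ x b|) := by
        rw [abs_mul, abs_mul, abs_mul, abs_mul, abs_of_nonneg (sq_nonneg (φ x)), abs_two]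
    _ ≤ energyDensity φ x * ‖fderiv ℝ η x‖ + |η x| * energyDensity φ x := by
        gcongr
        exact (sq_nonneg _).trans h5
    _ = _ := by ring

/-- The trace inequality near a boundary point. -/
lemma exists_trace_inequality_near {Ω : Set Plane} (hΩo : IsOpen Ω) (hΩL : HasLipschitzBoundary Ω)
    {x : Plane} (hx : x ∈ frontier Ω) :
    ∃ t ∈ 𝓝 x, ∃ C : NNReal, ∀ φ : Plane → ℝ, ContDiff ℝ ∞ φ →
      ∫⁻ y in t ∩ frontier Ω, ENNReal.ofReal (φ y ^ 2) ∂μH[1]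
        ≤ C * ∫⁻ y in Ω, ENNReal.ofReal (energyDensity φ y) := by
  obtain ⟨R, γ, K, r, hr, hγ, hch⟩ := hΩL x hx
  let η : ContDiffBump x := ⟨r / 3, r / 2, by positivity, by linarith⟩
  have hηd : ContDiff ℝ ∞ η := η.contDiff
  obtain ⟨M, hM⟩ : ∃ M, ∀ y, ‖fderiv ℝ η y‖ ≤ M :=
    (η.hasCompactSupport.fderiv (𝕜 := ℝ)).exists_bound_of_continuous
      (hηd.continuous_fderiv (by simp))
  have hM0 : 0 ≤ M := (norm_nonneg _).trans (hM x)
  set b : Plane := R.symm (EuclideanSpace.single 1 1) with hb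
  have hbn : ‖b‖ = 1 := by simp [hb]
  refine ⟨Metric.ball x (r / 3), Metric.ball_mem_nhds _ (by positivity),
    (1 + K) * (1 + M).toNNReal, fun φ hφ => ?_⟩
  set F : Plane → ℝ := fun y => η y * φ y ^ 2 with hF
  have hFd : ContDiff ℝ ∞ F := hηd.mul (hφ.pow 2)
  have hFs : tsupport F ⊆ Metric.ball x r := by
    refine (tsupport_mul_subset_left (f := η) (g := fun y => φ y ^ 2)).trans ?_
    rw [η.tsupport_eq]
    exact Metric.closedBall_subset_ball (by change r / 2 < r; linarith)
  have hFc : HasCompactSupport F := η.hasCompactSupport.mul_right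
  have hT : Metric.ball x (r / 3) ∩ frontier Ω ⊆ Set.range fun t => chartMap R (t, γ t) := by
    refine Set.Subset.trans ?_ (frontier_inter_ball_subset_graph hΩo hγ.continuous hch)
    exact fun y hy => ⟨hy.2, Metric.ball_subset_ball (by linarith) hy.1⟩
  have hmeas : Measurable fun y => ‖F y‖ₑ := hFd.continuous.measurable.enorm
  calc ∫⁻ y in Metric.ball x (r / 3) ∩ frontier Ω, ENNReal.ofReal (φ y ^ 2) ∂μH[1]
      ≤ ∫⁻ y in Metric.ball x (r / 3) ∩ frontier Ω, ‖F y‖ₑ ∂μH[1] := by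
        refine setLIntegral_mono' (measurableSet_ball.inter isClosed_frontier.measurableSet) ?_
        intro y hy
        have h1 : η y = 1 := η.one_of_mem_closedBall (Metric.ball_subset_closedBall hy.1)
        rw [hF]
        dsimp only
        rw [h1, one_mul, Real.enorm_of_nonneg (sq_nonneg _)]
    _ ≤ (1 + K : NNReal) * ∫⁻ t, ‖F (chartMap R (t, γ t))‖ₑ :=
        lintegral_hausdorffMeasure_graph_le R hγ hT hmeas
    _ ≤ (1 + K : NNReal) * ∫⁻ y in {y | γ (R y 0) < R y 1}, ‖fderiv ℝ F y b‖ₑ := by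
        gcongr
        exact lintegral_graph_le R hγ.continuous (hFd.of_le (by simp)) hFc
    _ ≤ (1 + K : NNReal) * ∫⁻ y in Ω,
          (1 + M).toNNReal * ENNReal.ofReal (energyDensity φ y) := by
        refine mul_le_mul_right ?_ _
        have hS : MeasurableSet {y : Plane | γ (R y 0) < R y 1} :=
          measurableSet_lt (hγ.continuous.measurable.comp (by fun_prop)) (by fun_prop)
        rw [← lintegral_indicator hS, ← lintegral_indicator hΩo.measurableSet]
        refine lintegral_mono fun y => ?_
        by_cases hy : y ∈ Metric.ball x r
        · by_cases hyΩ : y ∈ Ω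
          · rw [Set.indicator_of_mem hyΩ,
              Set.indicator_of_mem (show y ∈ {y : Plane | γ (R y 0) < R y 1} from (hch y hy).1 hyΩ)]
            have h1 := fderiv_mul_sq_le (hηd.differentiable (by simp))
              (hφ.differentiable (by simp)) y b hbn
            have h2 : (|η y| + ‖fderiv ℝ η y‖) * energyDensity φ y
                ≤ (1 + M) * energyDensity φ y := by
              gcongr
              · unfold energyDensity; positivity
              · rw [abs_of_nonneg η.nonneg]; exact η.le_one
              · exact hM y
            rw [Real.enorm_eq_ofReal_abs]
            refine (ENNReal.ofReal_le_ofReal (h1.trans h2)).trans (le_of_eq ?_)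
            rw [ENNReal.ofReal_mul (by positivity)]
            rfl
          · rw [Set.indicator_of_notMem
              (show y ∉ {y : Plane | γ (R y 0) < R y 1} from fun h => hyΩ ((hch y hy).2 h))]
            exact zero_le
        · have h0 : fderiv ℝ F y = 0 := by
            by_contra h
            exact hy (hFs (support_fderiv_subset ℝ h))
          refine le_trans (Set.indicator_le_self _ _ y) ?_
          rw [h0]
          simp
    _ = _ := by
        rw [lintegral_const_mul' _ _ ENNReal.coe_ne_top, ← mul_assoc, ENNReal.coe_mul]

/-- The trace inequality for smooth functions: the values on the boundary are controlled in
`L²(∂Ω)` by the `H¹(Ω)` norm. -/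
lemma exists_trace_inequality {Ω : Set Plane} (hΩo : IsOpen Ω) (hΩb : Bornology.IsBounded Ω)
    (hΩL : HasLipschitzBoundary Ω) :
    ∃ C : NNReal, ∀ φ : Plane → ℝ, ContDiff ℝ ∞ φ →
      ∫⁻ y, ENNReal.ofReal (φ y ^ 2) ∂(arcLength Ω)
        ≤ C * ∫⁻ y in Ω, ENNReal.ofReal (energyDensity φ y) := by
  have hcomp : IsCompact (frontier Ω) :=
    Metric.isCompact_of_isClosed_isBounded isClosed_frontier
      (hΩb.closure.subset frontier_subset_closure)
  have key := hcomp.induction_on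
    (p := fun S => ∃ C : NNReal, ∀ φ : Plane → ℝ, ContDiff ℝ ∞ φ →
      ∫⁻ y in S ∩ frontier Ω, ENNReal.ofReal (φ y ^ 2) ∂μH[1]
        ≤ C * ∫⁻ y in Ω, ENNReal.ofReal (energyDensity φ y))
    ⟨0, fun φ _ => by simp⟩
    (fun s t hst ⟨C, hC⟩ => ⟨C, fun φ hφ =>
      (lintegral_mono_set (Set.inter_subset_inter_left _ hst)).trans (hC φ hφ)⟩)
    (fun s t ⟨C, hC⟩ ⟨D, hD⟩ => ⟨C + D, fun φ hφ => by
      rw [Set.union_inter_distrib_right, ENNReal.coe_add, add_mul]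
      exact (lintegral_union_le _ _ _).trans (add_le_add (hC φ hφ) (hD φ hφ))⟩)
    (fun x hx => by
      obtain ⟨t, ht, h⟩ := exists_trace_inequality_near hΩo hΩL hx
      exact ⟨t, mem_nhdsWithin_of_mem_nhds ht, h⟩)
  simpa [arcLength] using key

/-- The trace inequality for the constant function `1` bounds the length of the boundary. -/
lemma isFiniteMeasure_arcLength {Ω : Set Plane} (hΩo : IsOpen Ω) (hΩb : Bornology.IsBounded Ω)
    (hΩL : HasLipschitzBoundary Ω) : IsFiniteMeasure (arcLength Ω) := by
  obtain ⟨C, hC⟩ := exists_trace_inequality hΩo hΩb hΩL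
  have h := hC (fun _ => 1) contDiff_const
  have h1 : energyDensity (fun _ => 1) = fun _ => 1 := by
    ext x
    simp [energyDensity]
  rw [h1] at h
  refine ⟨lt_of_le_of_lt (by simpa using h) ?_⟩
  exact ENNReal.mul_lt_top ENNReal.coe_lt_top hΩb.measure_lt_top

end TraceInequality

/-! ### Density of smooth functions in `H¹(Ω)` -/

section Density

open scoped Convolution ENNReal

/-- Near `x₀`, the set `Ω` absorbs small displacements in some direction `e`: points of `Ω` moved
by `s • e`, and by a further error below `δ * s`, stay in `Ω`. -/
def HasLocalCone (Ω : Set Plane) (x₀ : Plane) : Prop :=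
  ∃ r > 0, ∃ e : Plane, ∃ δ > 0, ∀ᶠ s in 𝓝[>] (0 : ℝ), ∀ x ∈ Ω, ∀ y ∈ Metric.ball x₀ r,
    ‖y - x - s • e‖ < δ * s → y ∈ Ω

lemma abs_coord_le_norm (x : Plane) (i : Fin 2) : |x i| ≤ ‖x‖ := by
  simpa using PiLp.norm_apply_le x i

/-- Interior points need no displacement (`e = 0`). At a boundary point `e` is the vertical direction of
the chart, with a cone narrow enough for the Lipschitz constant of the graph. -/
lemma hasLocalCone_of_mem_closure {Ω : Set Plane} (hΩo : IsOpen Ω) (hΩL : HasLipschitzBoundary Ω)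
    {x₀ : Plane} (hx₀ : x₀ ∈ closure Ω) : HasLocalCone Ω x₀ := by
  by_cases hx : x₀ ∈ Ω
  · obtain ⟨r, hr, h⟩ := Metric.isOpen_iff.1 hΩo x₀ hx
    exact ⟨r, hr, 0, 1, one_pos, Eventually.of_forall fun s x _ y hy _ => h hy⟩
  have hfr : x₀ ∈ frontier Ω := by
    rw [hΩo.frontier_eq]
    exact ⟨hx₀, hx⟩
  obtain ⟨R, γ, K, r, hr, hγ, hch⟩ := hΩL x₀ hfr
  set b : Plane := R.symm (EuclideanSpace.single 1 1) with hb
  have hbn : ‖b‖ = 1 := by simp [hb]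
  refine ⟨r / 2, by positivity, b, 1 / (K + 1), by positivity, ?_⟩
  have hs : ∀ᶠ s in 𝓝[>] (0 : ℝ), s < r / 4 :=
    nhdsWithin_le_nhds (eventually_lt_nhds (by positivity))
  filter_upwards [hs, self_mem_nhdsWithin] with s hsr hs0 x hxΩ y hy hxy
  have hs0 : 0 < s := hs0
  have hy' : y ∈ Metric.ball x₀ r := Metric.ball_subset_ball (by linarith) hy
  have hδ : 1 / ((K : ℝ) + 1) ≤ 1 := by
    rw [div_le_one (by positivity)]
    linarith [K.coe_nonneg]
  have hx' : x ∈ Metric.ball x₀ r := by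
    have h1 : ‖y - x‖ < 2 * s := by
      have h2 : ‖y - x‖ ≤ ‖y - x - s • b‖ + ‖s • b‖ := by
        simpa using norm_add_le (y - x - s • b) (s • b)
      have h3 : ‖s • b‖ = s := by rw [norm_smul, hbn, mul_one, Real.norm_of_nonneg hs0.le]
      nlinarith
    rw [Metric.mem_ball] at hy ⊢
    rw [← dist_eq_norm, dist_comm] at h1
    linarith [dist_triangle x y x₀]
  rw [hch y hy']
  have hxg := (hch x hx').1 hxΩ
  -- in the chart, the displacement is `(0, s)` up to an error below `s / (K + 1)`
  set d : Plane := R (y - x - s • b) with hd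
  have hdn : ‖d‖ < 1 / (K + 1) * s := by rwa [hd, LinearIsometryEquiv.norm_map]
  have hd0 : d 0 = R y 0 - R x 0 := by
    rw [hd, map_sub, map_sub, map_smul, hb, LinearIsometryEquiv.apply_symm_apply]
    simp
  have hd1 : d 1 = R y 1 - R x 1 - s := by
    rw [hd, map_sub, map_sub, map_smul, hb, LinearIsometryEquiv.apply_symm_apply]
    simp
  have h0 := abs_coord_le_norm d 0
  have h1 := neg_le_of_abs_le (abs_coord_le_norm d 1)
  have hL := hγ.dist_le_mul (R y 0) (R x 0)
  rw [Real.dist_eq, Real.dist_eq, ← hd0] at hL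
  have hL' := le_of_abs_le hL
  have h2 : (K : ℝ) * |d 0| ≤ K * ‖d‖ := mul_le_mul_of_nonneg_left h0 K.coe_nonneg
  have h3 : ((K : ℝ) + 1) * ‖d‖ < s := by
    have : ((K : ℝ) + 1) * ‖d‖ < (K + 1) * (1 / (K + 1) * s) := by gcongr
    rwa [← mul_assoc, mul_one_div_cancel (by positivity), one_mul] at this
  linarith

lemma memLp_indicator_mul {Ω : Set Plane} (hΩo : IsOpen Ω) (f : L2 Ω) {q : Plane → ℝ}
    (hq : Continuous q) (hqc : HasCompactSupport q) :
    MemLp (Ω.indicator fun x => q x * f x) 2 volume := by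
  rw [memLp_indicator_iff_restrict hΩo.measurableSet]
  obtain ⟨C, hC⟩ := hqc.exists_bound_of_continuous hq
  exact MemLp.of_le_mul (c := C) (Lp.memLp f)
    (hq.aestronglyMeasurable.mul (Lp.stronglyMeasurable f).aestronglyMeasurable)
    (Eventually.of_forall fun x => by
      rw [norm_mul]
      exact mul_le_mul_of_nonneg_right (hC x) (norm_nonneg _))

lemma measurable_indicator_mul {Ω : Set Plane} (hΩo : IsOpen Ω) (f : L2 Ω) {q : Plane → ℝ}
    (hq : Continuous q) : Measurable (Ω.indicator fun x => q x * f x) :=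
  (hq.measurable.mul (Lp.stronglyMeasurable f).measurable).indicator hΩo.measurableSet

lemma integral_indicator_mul {Ω : Set Plane} (hΩo : IsOpen Ω) (g q : Plane → ℝ) :
    ∫ x, Ω.indicator g x * q x = ∫ x in Ω, g x * q x := by
  rw [← integral_indicator hΩo.measurableSet]
  congr 1
  ext x
  by_cases hx : x ∈ Ω <;> simp [hx]

/-- The derivative of a mollified cut-off `η f` at a point `x` such that the mollifier based at `x`
sees only points of `Ω`: the derivative may be moved to `η f`. -/
lemma fderiv_convolution_cutoff {Ω : Set Plane} (hΩo : IsOpen Ω) {i : Fin 2} {f p : L2 Ω}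
    (hfp : IsWeakPartial Ω i f p) {η k : Plane → ℝ} (hη : ContDiff ℝ ∞ η)
    (hηc : HasCompactSupport η) (hk : ContDiff ℝ ∞ k) (hkc : HasCompactSupport k) {x : Plane}
    (hx : ∀ y ∈ tsupport η, x - y ∈ tsupport k → y ∈ Ω) :
    fderiv ℝ ((Ω.indicator fun y => η y * f y) ⋆[ContinuousLinearMap.mul ℝ ℝ] k) x
        (EuclideanSpace.single i 1)
      = ((Ω.indicator fun y => fderiv ℝ η y (EuclideanSpace.single i 1) * f y)
          ⋆[ContinuousLinearMap.mul ℝ ℝ] k) x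
        + ((Ω.indicator fun y => η y * p y) ⋆[ContinuousLinearMap.mul ℝ ℝ] k) x := by
  set e : Plane := EuclideanSpace.single i 1 with he
  have hloc : LocallyIntegrable (Ω.indicator fun y => η y * f y) volume :=
    (memLp_indicator_mul hΩo f hη.continuous hηc).locallyIntegrable (by norm_num)
  rw [(hkc.hasFDerivAt_convolution_right (ContinuousLinearMap.mul ℝ ℝ) hloc
      (hk.of_le (by simp)) x).fderiv,
    convolution_precompR_apply _ hloc (hkc.fderiv (𝕜 := ℝ)) (hk.continuous_fderiv (by simp))]
  simp only [convolution_def, ContinuousLinearMap.mul_apply']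
  rw [integral_indicator_mul hΩo _ (fun t => fderiv ℝ k (x - t) e),
    integral_indicator_mul hΩo _ (fun t => k (x - t)),
    integral_indicator_mul hΩo _ (fun t => k (x - t))]
  -- the test function is the cut-off mollifier based at `x`
  set ψ : Plane → ℝ := fun y => η y * k (x - y) with hψ
  have hkx : ContDiff ℝ ∞ fun y => k (x - y) := hk.comp (contDiff_const.sub contDiff_id)
  have hψd : ContDiff ℝ ∞ ψ := hη.mul hkx
  have hψc : HasCompactSupport ψ := hηc.mul_right
  have hψs : tsupport ψ ⊆ Ω := by
    have h1 : tsupport ψ ⊆ tsupport η ∩ (fun y => x - y) ⁻¹' tsupport k := by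
      refine closure_minimal (fun y hy => ?_)
        ((isClosed_tsupport η).inter ((isClosed_tsupport k).preimage (by fun_prop)))
      exact ⟨subset_tsupport η (left_ne_zero_of_mul hy),
        subset_tsupport k (right_ne_zero_of_mul hy)⟩
    exact fun y hy => hx y (h1 hy).1 (h1 hy).2
  have hψ' : ∀ y, fderiv ℝ ψ y e = fderiv ℝ η y e * k (x - y) - η y * fderiv ℝ k (x - y) e := by
    intro y
    have h1 : HasFDerivAt (fun y => k (x - y)) (-(fderiv ℝ k (x - y))) y := by
      have h2 : HasFDerivAt (fun y : Plane => x - y) (-(ContinuousLinearMap.id ℝ Plane)) y :=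
        (hasFDerivAt_id (𝕜 := ℝ) y).const_sub x
      refine (((hk.differentiable (by simp)) (x - y)).hasFDerivAt.comp y h2).congr_fderiv ?_
      ext v
      simp
    have h3 : HasFDerivAt ψ _ y := ((hη.differentiable (by simp)) y).hasFDerivAt.mul h1
    rw [h3.fderiv]
    simp
    ring
  have hweak := hfp ψ hψd hψc hψs
  have hprod : ∀ (g : L2 Ω) {q : Plane → ℝ}, Continuous q → HasCompactSupport q →
      Integrable (fun y => g y * q y) (volume.restrict Ω) := by
    intro g q hq hqc
    have hq2 : MemLp q 2 (volume.restrict Ω) := (hq.memLp_of_hasCompactSupport hqc).restrict Ω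
    exact (Lp.memLp g).integrable_mul hq2
  have hηe : Continuous fun y => fderiv ℝ η y e :=
    (hη.continuous_fderiv (by simp)).clm_apply continuous_const
  have hke : Continuous fun y => fderiv ℝ k (x - y) e :=
    ((hk.continuous_fderiv (by simp)).comp (by fun_prop)).clm_apply continuous_const
  have i1 := hprod f (q := fun y => fderiv ℝ η y e * k (x - y)) (hηe.mul hkx.continuous) ((hηc.fderiv_apply (𝕜 := ℝ) e).mul_right)
  have i2 := hprod f (q := fun y => η y * fderiv ℝ k (x - y) e) (hη.continuous.mul hke) hηc.mul_right
  have hsplit : ∫ y in Ω, f y * fderiv ℝ ψ y e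
      = (∫ y in Ω, f y * (fderiv ℝ η y e * k (x - y)))
        - ∫ y in Ω, f y * (η y * fderiv ℝ k (x - y) e) := by
    rw [← integral_sub i1 i2]
    refine integral_congr_ae (Eventually.of_forall fun y => ?_)
    dsimp only
    rw [hψ' y]
    ring
  rw [hsplit] at hweak
  have c1 : ∫ y in Ω, η y * f y * fderiv ℝ k (x - y) e
      = ∫ y in Ω, f y * (η y * fderiv ℝ k (x - y) e) := by congr 1; ext y; ring
  have c2 : ∫ y in Ω, fderiv ℝ η y e * f y * k (x - y)
      = ∫ y in Ω, f y * (fderiv ℝ η y e * k (x - y)) := by congr 1; ext y; ring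
  have c3 : ∫ y in Ω, η y * p y * k (x - y) = ∫ y in Ω, p y * ψ y := by
    congr 1; ext y; rw [hψ]; ring
  rw [c1, c2, c3]
  linarith

/-- A cut-off `η f` supported where the cone condition holds is approximated in `H¹(Ω)` by
mollifications, with mollifiers that look in the direction of the cone. -/
lemma exists_smooth_approx_cutoff {Ω : Set Plane} (hΩo : IsOpen Ω) {f : L2 Ω} {p : Fin 2 → L2 Ω}
    (hfp : ∀ i, IsWeakPartial Ω i f (p i)) {x₀ : Plane} {r : ℝ} {e : Plane} {δ : ℝ} (hδ : 0 < δ)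
    (hcone : ∀ᶠ s in 𝓝[>] (0 : ℝ), ∀ x ∈ Ω, ∀ y ∈ Metric.ball x₀ r,
      ‖y - x - s • e‖ < δ * s → y ∈ Ω)
    {η : Plane → ℝ} (hη : ContDiff ℝ ∞ η) (hηc : HasCompactSupport η)
    (hηs : tsupport η ⊆ Metric.ball x₀ r) {ε : ℝ≥0∞} (hε : 0 < ε) :
    ∃ φ : Plane → ℝ, ContDiff ℝ ∞ φ ∧
      eLpNorm (fun x => φ x - η x * f x) 2 (volume.restrict Ω) ≤ ε ∧
      ∀ i : Fin 2, eLpNorm (fun x => fderiv ℝ φ x (EuclideanSpace.single i 1)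
        - (fderiv ℝ η x (EuclideanSpace.single i 1) * f x + η x * p i x)) 2
          (volume.restrict Ω) ≤ ε := by
  have hηe : ∀ i : Fin 2, Continuous fun y => fderiv ℝ η y (EuclideanSpace.single i 1) := fun i =>
    (hη.continuous_fderiv (by simp)).clm_apply continuous_const
  have hηec : ∀ i : Fin 2,
      HasCompactSupport fun y => fderiv ℝ η y (EuclideanSpace.single i 1) := fun i =>
    hηc.fderiv_apply (𝕜 := ℝ) _
  set g : Plane → ℝ := Ω.indicator fun y => η y * f y with hg
  set g₁ : Fin 2 → Plane → ℝ := fun i =>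
    Ω.indicator fun y => fderiv ℝ η y (EuclideanSpace.single i 1) * f y with hg₁
  set g₂ : Fin 2 → Plane → ℝ := fun i => Ω.indicator fun y => η y * p i y with hg₂
  have hgL := memLp_indicator_mul hΩo f hη.continuous hηc
  have hg₁L := fun i => memLp_indicator_mul hΩo f (hηe i) (hηec i)
  have hg₂L := fun i => memLp_indicator_mul hΩo (p i) hη.continuous hηc
  have hε2 : 0 < ε / 2 := ENNReal.half_pos hε.ne'
  obtain ⟨ρ, hρ, hgt⟩ := exists_eLpNorm_translate_sub_le hgL hε2
  choose ρ₁ hρ₁ hg₁t using fun i => exists_eLpNorm_translate_sub_le (hg₁L i) hε2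
  choose ρ₂ hρ₂ hg₂t using fun i => exists_eLpNorm_translate_sub_le (hg₂L i) hε2
  have hsmall : ∀ ρ : ℝ, 0 < ρ → ∀ᶠ s in 𝓝[>] (0 : ℝ), s * (‖e‖ + δ) < ρ := by
    intro ρ hρ
    refine nhdsWithin_le_nhds ?_
    have : Tendsto (fun s : ℝ => s * (‖e‖ + δ)) (𝓝 0) (𝓝 (0 * (‖e‖ + δ))) :=
      (continuous_id.mul continuous_const).tendsto 0
    rw [zero_mul] at this
    exact this.eventually_lt_const hρ
  obtain ⟨s, ⟨⟨⟨hs, hsρ⟩, hsρ₁⟩, hsρ₂⟩, hs0⟩ := ((((hcone.and (hsmall ρ hρ)).and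
    (eventually_all.2 fun i => hsmall (ρ₁ i) (hρ₁ i))).and
    (eventually_all.2 fun i => hsmall (ρ₂ i) (hρ₂ i))).and
    (self_mem_nhdsWithin (a := (0 : ℝ)) (s := Set.Ioi 0))).exists
  have hs0 : 0 < s := hs0
  -- `k` lives near `-s • e`, so that `(k ⋆ g) x` averages `g` near `x + s • e`
  let B : ContDiffBump (-(s • e)) := ⟨δ * s / 3, δ * s / 2, by positivity, by
    have : 0 < δ * s := by positivity
    linarith⟩
  set k : Plane → ℝ := B.normed volume with hk
  have hkd : ContDiff ℝ ∞ k := B.contDiff_normed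
  have hkc : HasCompactSupport k := B.hasCompactSupport_normed
  have hkz : ∀ z ∈ tsupport k, ‖z + s • e‖ < δ * s := by
    intro z hz
    rw [hk, B.tsupport_normed_eq, Metric.mem_closedBall, dist_eq_norm, sub_neg_eq_add] at hz
    have : 0 < δ * s := by positivity
    exact lt_of_le_of_lt hz (by change δ * s / 2 < _; linarith)
  have hkn : ∀ z ∈ Function.support k, ‖z‖ ≤ s * (‖e‖ + δ) := by
    intro z hz
    have h1 := hkz z (subset_tsupport k hz)
    have h2 := norm_sub_le (z + s • e) (s • e)
    rw [add_sub_cancel_right, norm_smul, Real.norm_of_nonneg hs0.le] at h2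
    nlinarith
  have hswap : ∀ u : Plane → ℝ, k ⋆[ContinuousLinearMap.mul ℝ ℝ] u
      = u ⋆[ContinuousLinearMap.mul ℝ ℝ] k := by
    intro u
    ext x
    rw [convolution_mul_swap, convolution_mul]
    congr 1
    ext t
    ring
  have hclose : ∀ (u : Plane → ℝ), Measurable u → MemLp u 2 volume → ∀ ρ : ℝ,
      (∀ z, ‖z‖ < ρ → eLpNorm (fun x => u (x - z) - u x) 2 volume ≤ ε / 2) →
      s * (‖e‖ + δ) < ρ →
      eLpNorm (fun x => (u ⋆[ContinuousLinearMap.mul ℝ ℝ] k) x - u x) 2 volume ≤ ε / 2 := by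
    intro u hu huL ρ h hsρ
    rw [← hswap u]
    exact eLpNorm_convolution_sub_le hu huL hkd.continuous hkc (fun z => B.nonneg_normed z)
      B.integral_normed fun z hz => h z ((hkn z hz).trans_lt hsρ)
  have hgm := measurable_indicator_mul hΩo f hη.continuous
  have hg₁m := fun i => measurable_indicator_mul hΩo f (hηe i)
  have hg₂m := fun i => measurable_indicator_mul hΩo (p i) hη.continuous
  have hφ : ContDiff ℝ ∞ (g ⋆[ContinuousLinearMap.mul ℝ ℝ] k) :=
    hkc.contDiff_convolution_right _ (hgL.locallyIntegrable (by norm_num)) hkd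
  refine ⟨g ⋆[ContinuousLinearMap.mul ℝ ℝ] k, hφ, ?_, fun i => ?_⟩
  · have h1 : eLpNorm (fun x => (g ⋆[ContinuousLinearMap.mul ℝ ℝ] k) x - η x * f x) 2
        (volume.restrict Ω)
        = eLpNorm (fun x => (g ⋆[ContinuousLinearMap.mul ℝ ℝ] k) x - g x) 2
          (volume.restrict Ω) := by
      refine eLpNorm_congr_ae ?_
      filter_upwards [ae_restrict_mem hΩo.measurableSet] with x hx
      rw [hg, Set.indicator_of_mem hx]
    rw [h1]
    exact (eLpNorm_mono_measure _ Measure.restrict_le_self).trans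
      ((hclose g hgm hgL ρ hgt hsρ).trans ENNReal.half_le_self)
  · have h1 : eLpNorm (fun x => fderiv ℝ (g ⋆[ContinuousLinearMap.mul ℝ ℝ] k) x
          (EuclideanSpace.single i 1)
          - (fderiv ℝ η x (EuclideanSpace.single i 1) * f x + η x * p i x)) 2 (volume.restrict Ω)
        = eLpNorm ((fun x => (g₁ i ⋆[ContinuousLinearMap.mul ℝ ℝ] k) x - g₁ i x)
          + fun x => (g₂ i ⋆[ContinuousLinearMap.mul ℝ ℝ] k) x - g₂ i x) 2
          (volume.restrict Ω) := by
      refine eLpNorm_congr_ae ?_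
      filter_upwards [ae_restrict_mem hΩo.measurableSet] with x hx
      have h2 : ∀ y ∈ tsupport η, x - y ∈ tsupport k → y ∈ Ω := by
        intro y hy hxy
        refine hs x hx y (hηs hy) ?_
        have h3 : y - x - s • e = -(x - y + s • e) := by abel
        rw [h3, norm_neg]
        exact hkz _ hxy
      rw [fderiv_convolution_cutoff hΩo (hfp i) hη hηc hkd hkc h2, Pi.add_apply]
      simp only [hg₁, hg₂, Set.indicator_of_mem hx]
      ring
    rw [h1]
    have m1 : AEStronglyMeasurable (fun x => (g₁ i ⋆[ContinuousLinearMap.mul ℝ ℝ] k) x - g₁ i x)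
        (volume.restrict Ω) :=
      ((hkc.continuous_convolution_right _ ((hg₁L i).locallyIntegrable (by norm_num))
        hkd.continuous).measurable.sub (hg₁m i)).aestronglyMeasurable
    have m2 : AEStronglyMeasurable (fun x => (g₂ i ⋆[ContinuousLinearMap.mul ℝ ℝ] k) x - g₂ i x)
        (volume.restrict Ω) :=
      ((hkc.continuous_convolution_right _ ((hg₂L i).locallyIntegrable (by norm_num))
        hkd.continuous).measurable.sub (hg₂m i)).aestronglyMeasurable
    calc _ ≤ _ := eLpNorm_add_le m1 m2 (by norm_num)
      _ ≤ ε / 2 + ε / 2 := by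
          gcongr
          · exact (eLpNorm_mono_measure _ Measure.restrict_le_self).trans
              (hclose _ (hg₁m i) (hg₁L i) (ρ₁ i) (hg₁t i) (hsρ₁ i))
          · exact (eLpNorm_mono_measure _ Measure.restrict_le_self).trans
              (hclose _ (hg₂m i) (hg₂L i) (ρ₂ i) (hg₂t i) (hsρ₂ i))
      _ = ε := ENNReal.add_halves ε

/-- Smooth cut-offs subordinate to finitely many balls that cover a compact set. -/
lemma exists_finite_smooth_partition {S : Set Plane} (hS : IsCompact S) {r : Plane → ℝ}
    (hr : ∀ x ∈ S, 0 < r x) :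
    ∃ (t : Finset S) (η : t → Plane → ℝ), (∀ j, ContDiff ℝ ∞ (η j)) ∧
      (∀ j, tsupport (η j) ⊆ Metric.ball (j : S) (r (j : S))) ∧
      ∀ x ∈ S, ∑ j, η j x = 1 := by
  obtain ⟨t, ht⟩ := hS.elim_nhds_subcover' (fun x _ => Metric.ball x (r x))
    (fun x hx => Metric.ball_mem_nhds _ (hr x hx))
  obtain ⟨q, hq⟩ := SmoothPartitionOfUnity.exists_isSubordinate (modelWithCornersSelf ℝ Plane)
    hS.isClosed (fun j : t => Metric.ball ((j : S) : Plane) (r (j : S)))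
    (fun j => Metric.isOpen_ball) (by
      refine ht.trans fun x hx => ?_
      obtain ⟨j, hj, hxj⟩ := Set.mem_iUnion₂.1 hx
      exact Set.mem_iUnion.2 ⟨⟨j, hj⟩, hxj⟩)
  refine ⟨t, fun j => q j, fun j => (q j).contMDiff.contDiff, hq, fun x hx => ?_⟩
  rw [← finsum_eq_sum_of_fintype]
  exact q.sum_eq_one hx

/-- Functions smooth on the whole plane are dense in `H¹(Ω)`. -/
lemma exists_smooth_approx {Ω : Set Plane} (hΩo : IsOpen Ω) (hΩb : Bornology.IsBounded Ω)
    (hΩL : HasLipschitzBoundary Ω) {f : L2 Ω} {p : Fin 2 → L2 Ω}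
    (hfp : ∀ i, IsWeakPartial Ω i f (p i)) {ε : ℝ≥0∞} (hε : 0 < ε) :
    ∃ φ : Plane → ℝ, ContDiff ℝ ∞ φ ∧
      eLpNorm (fun x => φ x - f x) 2 (volume.restrict Ω) ≤ ε ∧
      ∀ i : Fin 2, eLpNorm (fun x => fderiv ℝ φ x (EuclideanSpace.single i 1) - p i x) 2
          (volume.restrict Ω) ≤ ε := by
  have hS : IsCompact (closure Ω) :=
    Metric.isCompact_of_isClosed_isBounded isClosed_closure hΩb.closure
  have hcone := fun (x : Plane) (hx : x ∈ closure Ω) => hasLocalCone_of_mem_closure hΩo hΩL hx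
  choose! r hr e δ hδ hc using hcone
  obtain ⟨t, η, hηd, hηs, hη1⟩ := exists_finite_smooth_partition hS hr
  have hηc : ∀ j, HasCompactSupport (η j) := fun j =>
    HasCompactSupport.of_support_subset_isCompact (isCompact_closedBall _ _)
      ((subset_tsupport _).trans ((hηs j).trans Metric.ball_subset_closedBall))
  have hN : (0 : ℝ≥0∞) < ε / (t.card + 1) :=
    ENNReal.div_pos hε.ne' (by finiteness)
  choose φ hφd hφ hφ' using fun j : t => exists_smooth_approx_cutoff hΩo hfp
    (hδ _ (j : closure Ω).2) (hc _ (j : closure Ω).2) (hηd j) (hηc j) (hηs j) hN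
  have hsum : ∑ _j : t, ε / (t.card + 1) ≤ ε := by
    rw [Finset.sum_const, Finset.card_univ, Fintype.card_coe, nsmul_eq_mul]
    calc (t.card : ℝ≥0∞) * (ε / (t.card + 1)) ≤ (t.card + 1) * (ε / (t.card + 1)) := by
          gcongr
          exact le_self_add
      _ ≤ ε := ENNReal.mul_div_le
  have hfm : AEStronglyMeasurable f (volume.restrict Ω) :=
    (Lp.stronglyMeasurable f).aestronglyMeasurable
  have hpm : ∀ i, AEStronglyMeasurable (p i) (volume.restrict Ω) := fun i =>
    (Lp.stronglyMeasurable (p i)).aestronglyMeasurable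
  refine ⟨fun x => ∑ j, φ j x, ContDiff.sum fun j _ => hφd j, ?_, fun i => ?_⟩
  · have h1 : eLpNorm (fun x => ∑ j, φ j x - f x) 2 (volume.restrict Ω)
        = eLpNorm (∑ j, fun x => φ j x - η j x * f x) 2 (volume.restrict Ω) := by
      refine eLpNorm_congr_ae ?_
      filter_upwards [ae_restrict_mem hΩo.measurableSet] with x hx
      rw [Finset.sum_apply, Finset.sum_sub_distrib, ← Finset.sum_mul,
        hη1 x (subset_closure hx), one_mul]
    rw [h1]
    refine (eLpNorm_sum_le (fun j _ => ?_) (by norm_num)).trans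
      ((Finset.sum_le_sum fun j _ => hφ j).trans hsum)
    exact (hφd j).continuous.aestronglyMeasurable.sub
      ((hηd j).continuous.aestronglyMeasurable.mul hfm)
  · have h1 : eLpNorm (fun x => fderiv ℝ (fun x => ∑ j, φ j x) x (EuclideanSpace.single i 1)
          - p i x) 2 (volume.restrict Ω)
        = eLpNorm (∑ j, fun x => fderiv ℝ (φ j) x (EuclideanSpace.single i 1)
          - (fderiv ℝ (η j) x (EuclideanSpace.single i 1) * f x + η j x * p i x)) 2
          (volume.restrict Ω) := by
      refine eLpNorm_congr_ae ?_
      filter_upwards [ae_restrict_mem hΩo.measurableSet] with x hx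
      -- the cut-offs sum to a constant near `x`, so their derivatives cancel
      have h2 : ∑ j, fderiv ℝ (η j) x (EuclideanSpace.single i 1) = 0 := by
        have h3 : fderiv ℝ (fun x => ∑ j, η j x) x = 0 := by
          have h4 : (fun x => ∑ j, η j x) =ᶠ[𝓝 x] fun _ => 1 := by
            filter_upwards [hΩo.mem_nhds hx] with y hy
            exact hη1 y (subset_closure hy)
          rw [h4.fderiv_eq, fderiv_fun_const]
          rfl
        rw [fderiv_fun_sum fun j _ => ((hηd j).differentiable (by simp)).differentiableAt] at h3
        have h5 := congrArg (fun T : Plane →L[ℝ] ℝ => T (EuclideanSpace.single i 1)) h3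
        simpa using h5
      rw [fderiv_fun_sum fun j _ => ((hφd j).differentiable (by simp)).differentiableAt,
        Finset.sum_apply, Finset.sum_sub_distrib, Finset.sum_add_distrib, ← Finset.sum_mul,
        ← Finset.sum_mul, hη1 x (subset_closure hx), h2, one_mul, zero_mul, zero_add]
      simp
    rw [h1]
    refine (eLpNorm_sum_le (fun j _ => ?_) (by norm_num)).trans
      ((Finset.sum_le_sum fun j _ => hφ' j i).trans hsum)
    have hce : ∀ {u : Plane → ℝ}, ContDiff ℝ ∞ u →
        Continuous fun x => fderiv ℝ u x (EuclideanSpace.single i 1) := fun hu =>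
      (hu.continuous_fderiv (by simp)).clm_apply continuous_const
    exact (hce (hφd j)).aestronglyMeasurable.sub
      (((hce (hηd j)).aestronglyMeasurable.mul hfm).add
        ((hηd j).continuous.aestronglyMeasurable.mul (hpm i)))

end Density

/-! ### Closures of bounded linear relations -/

section ClosedGraph

variable {X Y : Type*} [NormedAddCommGroup X] [NormedSpace ℝ X] [NormedAddCommGroup Y]
  [NormedSpace ℝ Y] [CompleteSpace Y]

/-- A bounded linear relation whose domain is dense has a closure that is the graph of a bounded
operator. -/
lemma exists_clm_of_graph_bound (S : Submodule ℝ (X × Y)) {C : ℝ} (hC0 : 0 ≤ C)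
    (hC : ∀ p ∈ S, ‖p.2‖ ≤ C * ‖p.1‖) (hd : ∀ x, ∀ ε > 0, ∃ p ∈ S, ‖p.1 - x‖ ≤ ε) :
    ∃ T : X →L[ℝ] Y, ∀ x y, (x, y) ∈ closure (S : Set (X × Y)) ↔ y = T x := by
  have hbound : ∀ p ∈ S.topologicalClosure, ‖p.2‖ ≤ C * ‖p.1‖ := by
    have hcl : IsClosed {p : X × Y | ‖p.2‖ ≤ C * ‖p.1‖} :=
      isClosed_le (by fun_prop) (by fun_prop)
    exact fun p hp => closure_minimal hC hcl hp
  have hex : ∀ x, ∃ y, (x, y) ∈ S.topologicalClosure := by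
    intro x
    choose p hp hpx using fun n : ℕ => hd x (1 / ((n : ℝ) + 1)) (by positivity)
    have hlim : Tendsto (fun n => (p n).1) atTop (𝓝 x) := by
      rw [tendsto_iff_norm_sub_tendsto_zero]
      exact squeeze_zero (fun n => norm_nonneg _) hpx tendsto_one_div_add_atTop_nhds_zero_nat
    have hcauchy : CauchySeq fun n => (p n).2 := by
      have h1 := hlim.cauchySeq
      rw [Metric.cauchySeq_iff'] at h1 ⊢
      intro ε hε
      obtain ⟨N, hN⟩ := h1 (ε / (C + 1)) (by positivity)
      refine ⟨N, fun n hn => ?_⟩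
      have h2 : ‖(p n).2 - (p N).2‖ ≤ C * ‖(p n).1 - (p N).1‖ := hC _ (S.sub_mem (hp n) (hp N))
      have h3 := hN n hn
      rw [dist_eq_norm] at h3 ⊢
      rw [lt_div_iff₀ (by positivity)] at h3
      nlinarith [norm_nonneg ((p n).1 - (p N).1)]
    obtain ⟨y, hy⟩ := cauchySeq_tendsto_of_complete hcauchy
    exact ⟨y, mem_closure_of_tendsto (hlim.prodMk_nhds hy) (Eventually.of_forall hp)⟩
  have huniq : ∀ x y y', (x, y) ∈ S.topologicalClosure → (x, y') ∈ S.topologicalClosure →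
      y = y' := by
    intro x y y' h h'
    have h1 := hbound _ (Submodule.sub_mem _ h h')
    rw [Prod.mk_sub_mk, sub_self, norm_zero, mul_zero] at h1
    exact sub_eq_zero.1 (norm_le_zero_iff.1 h1)
  choose T hT using hex
  let T' : X →ₗ[ℝ] Y :=
    { toFun := T
      map_add' := fun v w => huniq _ _ _ (hT _) (Submodule.add_mem _ (hT v) (hT w))
      map_smul' := fun c w => huniq _ _ _ (hT _) (Submodule.smul_mem _ c (hT w)) }
  refine ⟨T'.mkContinuous C fun w => hbound _ (hT w), fun x y => ⟨fun h => ?_, ?_⟩⟩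
  · exact huniq _ _ _ h (hT x)
  · rintro rfl
    exact hT x

end ClosedGraph

/-! ### The trace operator -/

section TraceOperator

open scoped ENNReal

variable {Ω : Set Plane}

lemma memLp_of_continuous_of_ae_mem {μ : Measure Plane} [IsFiniteMeasure μ] {S : Set Plane}
    (hS : IsCompact S) (h : ∀ᵐ x ∂μ, x ∈ S) {q : Plane → ℝ} (hq : Continuous q) : MemLp q 2 μ := by
  obtain ⟨C, hC⟩ := hS.exists_bound_of_continuousOn hq.continuousOn
  exact MemLp.of_bound hq.aestronglyMeasurable C (h.mono hC)

lemma memLp_restrict_of_continuous (hΩo : IsOpen Ω) (hΩb : Bornology.IsBounded Ω) {q : Plane → ℝ}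
    (hq : Continuous q) : MemLp q 2 (volume.restrict Ω) := by
  have hfin : IsFiniteMeasure (volume.restrict Ω) :=
    isFiniteMeasure_restrict.2 hΩb.measure_lt_top.ne
  refine memLp_of_continuous_of_ae_mem (S := closure Ω)
    (Metric.isCompact_of_isClosed_isBounded isClosed_closure hΩb.closure) ?_ hq
  filter_upwards [ae_restrict_mem hΩo.measurableSet] with x hx using subset_closure hx

/-- Integration by parts against a test function. -/
lemma isWeakPartial_of_contDiff {i : Fin 2} {φ : Plane → ℝ} (hφ : ContDiff ℝ ∞ φ) {f p : L2 Ω}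
    (hf : f =ᵐ[volume.restrict Ω] φ)
    (hp : p =ᵐ[volume.restrict Ω] fun x => fderiv ℝ φ x (EuclideanSpace.single i 1)) :
    IsWeakPartial Ω i f p := by
  intro ψ hψ hψc hψs
  set e : Plane := EuclideanSpace.single i 1
  have hφe : Continuous fun x => fderiv ℝ φ x e :=
    (hφ.continuous_fderiv (by simp)).clm_apply continuous_const
  have hψe : Continuous fun x => fderiv ℝ ψ x e :=
    (hψ.continuous_fderiv (by simp)).clm_apply continuous_const
  have hψec : HasCompactSupport fun x => fderiv ℝ ψ x e := hψc.fderiv_apply (𝕜 := ℝ) e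
  have h1 : ∫ x in Ω, f x * fderiv ℝ ψ x e = ∫ x, φ x * fderiv ℝ ψ x e := by
    have h2 : ∫ x in Ω, f x * fderiv ℝ ψ x e = ∫ x in Ω, φ x * fderiv ℝ ψ x e :=
      integral_congr_ae (by filter_upwards [hf] with x hx; rw [hx])
    rw [h2]
    refine setIntegral_eq_integral_of_forall_compl_eq_zero fun x hx => ?_
    have h3 : fderiv ℝ ψ x = 0 := by
      by_contra h
      exact hx (hψs (support_fderiv_subset ℝ h))
    rw [h3]
    simp
  have h2 : ∫ x in Ω, p x * ψ x = ∫ x, fderiv ℝ φ x e * ψ x := by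
    have h2 : ∫ x in Ω, p x * ψ x = ∫ x in Ω, fderiv ℝ φ x e * ψ x :=
      integral_congr_ae (by filter_upwards [hp] with x hx; rw [hx])
    rw [h2]
    refine setIntegral_eq_integral_of_forall_compl_eq_zero fun x hx => ?_
    have h3 : ψ x = 0 := by
      by_contra h
      exact hx (hψs (subset_tsupport ψ h))
    rw [h3, mul_zero]
  rw [h1, h2]
  exact integral_mul_fderiv_eq_neg_fderiv_mul_of_integrable
    ((hφe.mul hψ.continuous).integrable_of_hasCompactSupport hψc.mul_left)
    ((hφ.continuous.mul hψe).integrable_of_hasCompactSupport hψec.mul_left)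
    ((hφ.continuous.mul hψ.continuous).integrable_of_hasCompactSupport hψc.mul_left)
    (fun x _ => (hφ.differentiable (by simp)) x) (fun x _ => (hψ.differentiable (by simp)) x)

/-- The weak partial derivative is unique. -/
lemma isWeakPartial_unique (hΩo : IsOpen Ω) {i : Fin 2} {f p q : L2 Ω}
    (hp : IsWeakPartial Ω i f p) (hq : IsWeakPartial Ω i f q) : p = q := by
  have hprod : ∀ (g : L2 Ω) {ψ : Plane → ℝ}, ContDiff ℝ ∞ ψ → HasCompactSupport ψ →
      Integrable (fun y => g y * ψ y) (volume.restrict Ω) := by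
    intro g ψ hψ hψc
    have h2 : MemLp ψ 2 (volume.restrict Ω) := (memLp_test hψ hψc).1
    exact (Lp.memLp g).integrable_mul h2
  have hloc : LocallyIntegrableOn (fun x => p x - q x) Ω volume := by
    have h1 : LocallyIntegrable (fun x => p x - q x) (volume.restrict Ω) :=
      ((Lp.memLp p).sub (Lp.memLp q)).locallyIntegrable (by norm_num)
    exact locallyIntegrableOn_of_locallyIntegrable_restrict h1
  have h := hΩo.ae_eq_zero_of_integral_contDiff_smul_eq_zero hloc (fun ψ hψ hψc hψs => by
    have h1 := hp ψ hψ hψc hψs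
    rw [hq ψ hψ hψc hψs, neg_inj] at h1
    have h2 : ∫ x, ψ x • (p x - q x) = ∫ x in Ω, ψ x • (p x - q x) := by
      refine (setIntegral_eq_integral_of_forall_compl_eq_zero fun x hx => ?_).symm
      have h3 : ψ x = 0 := by
        by_contra h
        exact hx (hψs (subset_tsupport ψ h))
      rw [h3, zero_smul]
    have h3 : ∫ x in Ω, ψ x • (p x - q x)
        = (∫ x in Ω, p x * ψ x) - ∫ x in Ω, q x * ψ x := by
      rw [← integral_sub (hprod p hψ hψc) (hprod q hψ hψc)]
      congr 1
      ext x
      rw [smul_eq_mul]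
      ring
    rw [h2, h3, h1, sub_self])
  refine Lp.ext ?_
  filter_upwards [(ae_restrict_iff' hΩo.measurableSet).2 h] with x hx
  exact sub_eq_zero.1 hx

lemma norm_sq_H1 (w : H1 Ω) :
    ‖w‖ ^ 2 = ‖w.1.fst‖ ^ 2 + (‖w.1.snd 0‖ ^ 2 + ‖w.1.snd 1‖ ^ 2) := by
  rw [Submodule.coe_norm, WithLp.prod_norm_sq_eq_of_L2, PiLp.norm_sq_eq_of_L2, Fin.sum_univ_two]

lemma norm_sq_lp_two {X : Type*} [MeasurableSpace X] {μ : Measure X} (f : Lp ℝ 2 μ) {q : X → ℝ}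
    (h : f =ᵐ[μ] q) : ENNReal.ofReal (‖f‖ ^ 2) = ∫⁻ x, ENNReal.ofReal (q x ^ 2) ∂μ := by
  rw [ENNReal.ofReal_pow (norm_nonneg _), Lp.norm_def, ENNReal.ofReal_toReal (Lp.eLpNorm_ne_top f),
    eLpNorm_congr_ae h, eLpNorm_two_sq]
  refine lintegral_congr fun x => ?_
  rw [Real.enorm_eq_ofReal_abs, ← ENNReal.ofReal_pow (abs_nonneg _), sq_abs]

lemma norm_fderiv_sq_le (φ : Plane → ℝ) (x : Plane) :
    ‖fderiv ℝ φ x‖ ^ 2 ≤ 2 * (fderiv ℝ φ x (EuclideanSpace.single 0 1) ^ 2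
      + fderiv ℝ φ x (EuclideanSpace.single 1 1) ^ 2) := by
  set T := fderiv ℝ φ x
  have h1 : ‖T‖ ≤ |T (EuclideanSpace.single 0 1)| + |T (EuclideanSpace.single 1 1)| := by
    refine T.opNorm_le_bound (by positivity) fun v => ?_
    have hv : v = v 0 • EuclideanSpace.single 0 1 + v 1 • EuclideanSpace.single 1 1 := by
      ext i
      fin_cases i <;> simp
    have h2 : T v = v 0 * T (EuclideanSpace.single 0 1) + v 1 * T (EuclideanSpace.single 1 1) := by
      conv_lhs => rw [hv, map_add, map_smul, map_smul, smul_eq_mul, smul_eq_mul]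
    rw [h2, Real.norm_eq_abs]
    refine (abs_add_le _ _).trans ?_
    rw [abs_mul, abs_mul, add_mul, mul_comm |v 0|, mul_comm |v 1|]
    gcongr
    · exact abs_coord_le_norm v 0
    · exact abs_coord_le_norm v 1
  nlinarith [sq_nonneg (|T (EuclideanSpace.single 0 1)| - |T (EuclideanSpace.single 1 1)|),
    sq_abs (T (EuclideanSpace.single 0 1)), sq_abs (T (EuclideanSpace.single 1 1)),
    norm_nonneg T, pow_le_pow_left₀ (norm_nonneg T) h1 2]

/-- The smooth trace graph as a linear subspace. -/
noncomputable def smoothTraceSubmodule (Ω : Set Plane) : Submodule ℝ (H1 Ω × L2Bdry Ω) where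
  carrier := smoothTraceGraph Ω
  zero_mem' := ⟨fun _ => 0, contDiff_const, Lp.coeFn_zero ℝ 2 _, Lp.coeFn_zero ℝ 2 _⟩
  add_mem' := by
    rintro a b ⟨φ, hφ, h1, h2⟩ ⟨ψ, hψ, h3, h4⟩
    refine ⟨fun x => φ x + ψ x, hφ.add hψ, ?_, ?_⟩
    · refine (Lp.coeFn_add a.1.1.fst b.1.1.fst).trans ?_
      filter_upwards [h1, h3] with x hx hx'
      rw [Pi.add_apply, hx, hx']
    · refine (Lp.coeFn_add a.2 b.2).trans ?_
      filter_upwards [h2, h4] with x hx hx'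
      rw [Pi.add_apply, hx, hx']
  smul_mem' := by
    rintro c a ⟨φ, hφ, h1, h2⟩
    refine ⟨fun x => c * φ x, contDiff_const.mul hφ, ?_, ?_⟩
    · refine (Lp.coeFn_smul c a.1.1.fst).trans ?_
      filter_upwards [h1] with x hx
      rw [Pi.smul_apply, hx, smul_eq_mul]
    · refine (Lp.coeFn_smul c a.2).trans ?_
      filter_upwards [h2] with x hx
      rw [Pi.smul_apply, hx, smul_eq_mul]

/-- The trace inequality on the smooth trace graph. -/
lemma exists_norm_le_of_mem_smoothTraceGraph (hΩo : IsOpen Ω) (hΩb : Bornology.IsBounded Ω)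
    (hΩL : HasLipschitzBoundary Ω) :
    ∃ C : ℝ, 0 ≤ C ∧ ∀ p ∈ smoothTraceGraph Ω, ‖p.2‖ ≤ C * ‖p.1‖ := by
  obtain ⟨C, hC⟩ := exists_trace_inequality hΩo hΩb hΩL
  refine ⟨Real.sqrt (2 * C), Real.sqrt_nonneg _, ?_⟩
  rintro ⟨w, t⟩ ⟨φ, hφ, hw, ht⟩
  change ‖t‖ ≤ Real.sqrt (2 * C) * ‖w‖
  have hφe : ∀ i : Fin 2, Continuous fun x => fderiv ℝ φ x (EuclideanSpace.single i 1) := fun i =>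
    (hφ.continuous_fderiv (by simp)).clm_apply continuous_const
  -- the graph only records that `w` agrees with `φ`; uniqueness of weak derivatives gives the rest
  have hgrad : ∀ i : Fin 2, w.1.snd i =ᵐ[volume.restrict Ω]
      fun x => fderiv ℝ φ x (EuclideanSpace.single i 1) := by
    intro i
    have hm := memLp_restrict_of_continuous hΩo hΩb (hφe i)
    have h1 : w.1.snd i = hm.toLp _ :=
      isWeakPartial_unique hΩo (w.2 i) (isWeakPartial_of_contDiff hφ hw hm.coeFn_toLp)
    rw [h1]
    exact hm.coeFn_toLp
  have h1 : ENNReal.ofReal (‖t‖ ^ 2) ≤ ENNReal.ofReal (2 * C * ‖w‖ ^ 2) := by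
    rw [norm_sq_lp_two t ht]
    refine (hC φ hφ).trans ?_
    have h2 : ∫⁻ y in Ω, ENNReal.ofReal (energyDensity φ y) ≤ ENNReal.ofReal (2 * ‖w‖ ^ 2) := by
      have m0 : Measurable fun x => ENNReal.ofReal (φ x ^ 2) :=
        (hφ.continuous.measurable.pow_const 2).ennreal_ofReal
      have m1 : Measurable fun x =>
          ENNReal.ofReal (fderiv ℝ φ x (EuclideanSpace.single 0 1) ^ 2) :=
        ((hφe 0).measurable.pow_const 2).ennreal_ofReal
      rw [norm_sq_H1, ENNReal.ofReal_mul zero_le_two,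
        ENNReal.ofReal_add (by positivity) (by positivity),
        ENNReal.ofReal_add (by positivity) (by positivity), norm_sq_lp_two _ hw,
        norm_sq_lp_two _ (hgrad 0), norm_sq_lp_two _ (hgrad 1), ← lintegral_add_left m1,
        ← lintegral_add_left m0, ← lintegral_const_mul' _ _ ENNReal.ofReal_ne_top]
      refine lintegral_mono fun x => ?_
      rw [← ENNReal.ofReal_add (by positivity) (by positivity),
        ← ENNReal.ofReal_add (by positivity) (by positivity), ← ENNReal.ofReal_mul zero_le_two]
      refine ENNReal.ofReal_le_ofReal ?_
      unfold energyDensity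
      linarith [norm_fderiv_sq_le φ x, sq_nonneg (φ x)]
    calc _ ≤ (C : ℝ≥0∞) * ENNReal.ofReal (2 * ‖w‖ ^ 2) := by gcongr
      _ = _ := by
          rw [← ENNReal.ofReal_coe_nnreal, ← ENNReal.ofReal_mul C.coe_nonneg]
          congr 1
          ring
  rw [ENNReal.ofReal_le_ofReal_iff (by positivity)] at h1
  refine abs_le_of_sq_le_sq' ?_ (by positivity) |>.2
  rw [mul_pow, Real.sq_sqrt (by positivity)]
  exact h1

/-- The elements of `H¹(Ω)` that are restrictions of smooth functions are dense. -/
lemma exists_mem_smoothTraceGraph_near (hΩo : IsOpen Ω) (hΩb : Bornology.IsBounded Ω)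
    (hΩL : HasLipschitzBoundary Ω) (w : H1 Ω) {ε : ℝ} (hε : 0 < ε) :
    ∃ p ∈ smoothTraceGraph Ω, ‖p.1 - w‖ ≤ ε := by
  have hfin := isFiniteMeasure_arcLength hΩo hΩb hΩL
  obtain ⟨φ, hφ, h0, h1⟩ := exists_smooth_approx hΩo hΩb hΩL (p := fun i => w.1.snd i) w.2
    (ε := ENNReal.ofReal (ε / 2)) (by positivity)
  have hφe : ∀ i : Fin 2, Continuous fun x => fderiv ℝ φ x (EuclideanSpace.single i 1) := fun i =>
    (hφ.continuous_fderiv (by simp)).clm_apply continuous_const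
  have hm := memLp_restrict_of_continuous hΩo hΩb hφ.continuous
  have hme := fun i => memLp_restrict_of_continuous hΩo hΩb (hφe i)
  have hmb : MemLp φ 2 (arcLength Ω) :=
    memLp_of_continuous_of_ae_mem (μ := arcLength Ω) (S := frontier Ω)
      (Metric.isCompact_of_isClosed_isBounded isClosed_frontier
        (hΩb.closure.subset frontier_subset_closure))
      (ae_restrict_mem isClosed_frontier.measurableSet) hφ.continuous
  let v : H1 Ω := ⟨WithLp.toLp 2 (hm.toLp φ, WithLp.toLp 2 fun i => (hme i).toLp _), fun i =>
    isWeakPartial_of_contDiff hφ hm.coeFn_toLp (hme i).coeFn_toLp⟩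
  refine ⟨(v, hmb.toLp φ), ⟨φ, hφ, hm.coeFn_toLp, hmb.coeFn_toLp⟩, ?_⟩
  have hclose : ∀ (f : L2 Ω) {q : Plane → ℝ} (hq : MemLp q 2 (volume.restrict Ω)),
      eLpNorm (fun x => q x - f x) 2 (volume.restrict Ω) ≤ ENNReal.ofReal (ε / 2) →
      ‖hq.toLp q - f‖ ≤ ε / 2 := by
    intro f q hq h
    rw [Lp.norm_def]
    refine ENNReal.toReal_le_of_le_ofReal (by positivity) (le_trans (le_of_eq ?_) h)
    refine eLpNorm_congr_ae ((Lp.coeFn_sub _ _).trans ?_)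
    filter_upwards [hq.coeFn_toLp] with x hx
    rw [Pi.sub_apply, hx]
  have n0 : ‖(v - w).1.fst‖ ≤ ε / 2 := hclose w.1.fst hm h0
  have n1 : ∀ i : Fin 2, ‖(v - w).1.snd i‖ ≤ ε / 2 := fun i => hclose (w.1.snd i) (hme i) (h1 i)
  change ‖v - w‖ ≤ ε
  refine abs_le_of_sq_le_sq' ?_ hε.le |>.2
  rw [norm_sq_H1]
  nlinarith [pow_le_pow_left₀ (norm_nonneg _) n0 2, pow_le_pow_left₀ (norm_nonneg _) (n1 0) 2,
    pow_le_pow_left₀ (norm_nonneg _) (n1 1) 2]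

/-- The trace as a bounded linear operator. -/
lemma exists_traceCLM (hΩo : IsOpen Ω) (hΩb : Bornology.IsBounded Ω)
    (hΩL : HasLipschitzBoundary Ω) :
    ∃ T : H1 Ω →L[ℝ] L2Bdry Ω, ∀ w, T w = trace Ω w := by
  obtain ⟨C, hC0, hC⟩ := exists_norm_le_of_mem_smoothTraceGraph hΩo hΩb hΩL
  obtain ⟨T, hT⟩ := exists_clm_of_graph_bound (smoothTraceSubmodule Ω) hC0 hC
    (fun w ε hε => exists_mem_smoothTraceGraph_near hΩo hΩb hΩL w hε)
  refine ⟨T, fun w => ((hT w (trace Ω w)).1 ?_).symm⟩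
  exact Classical.epsilon_spec (p := IsTrace Ω w) ⟨T w, (hT w (T w)).2 rfl⟩

/-- The boundary functional is the `[L²(∂Ω)]²` inner product with the trace. -/
lemma exists_bdryFunctional_eq_inner (hΩo : IsOpen Ω) (hΩb : Bornology.IsBounded Ω)
    (hΩL : HasLipschitzBoundary Ω) :
    ∃ T : H1Vec Ω →L[ℝ] L2BdryVec Ω, ∀ g v, bdryFunctional Ω g v = inner ℝ g (T v) := by
  obtain ⟨T, hT⟩ := exists_traceCLM hΩo hΩb hΩL
  refine ⟨((PiLp.continuousLinearEquiv 2 ℝ (fun _ : Fin 2 => L2Bdry Ω)).symm :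
      (Fin 2 → L2Bdry Ω) →L[ℝ] L2BdryVec Ω) ∘L
    ContinuousLinearMap.pi fun i => T ∘L PiLp.proj 2 (fun _ : Fin 2 => H1 Ω) i, fun g v => ?_⟩
  have h1 : ∀ i : Fin 2, inner ℝ (g i) (trace Ω (v i))
      = ∫ x, g i x * trace Ω (v i) x ∂(arcLength Ω) := by
    intro i
    rw [L2.inner_def]
    congr 1
    ext x
    rw [real_inner_comm]
    rfl
  have h2 : ∀ i : Fin 2, Integrable (fun x => g i x * trace Ω (v i) x) (arcLength Ω) :=
    fun i => (Lp.memLp (g i)).integrable_mul (Lp.memLp (trace Ω (v i)))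
  rw [PiLp.inner_apply, bdryFunctional]
  change ∫ x, (∑ i : Fin 2, g i x * trace Ω (v i) x) ∂(arcLength Ω)
    = ∑ i : Fin 2, inner ℝ (g i) (T (v i))
  rw [integral_finsetSum _ fun i _ => h2 i]
  exact Finset.sum_congr rfl fun i _ => by rw [hT, h1]

end TraceOperator

/-! ### The regularised boundary problem -/

theorem proposition3p5
    (Ω : Set Plane) (hΩo : IsOpen Ω) (hΩc : IsConnected Ω) (hΩb : Bornology.IsBounded Ω)
    (hΩL : HasLipschitzBoundary Ω)
    {H : Type*} [NormedAddCommGroup H] [InnerProductSpace ℝ H] [CompleteSpace H]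
    (ι : H →L[ℝ] H1Vec Ω) (hι : Function.Injective ι) :
    (∀ g : L2BdryVec Ω,
      (∃! φ : H, IsRieszRep Ω ι g φ) ∧
      ∀ α : ℝ, 0 < α → ∃! u : H, IsMinimiser Ω ι g α u) ∧
    ∃ C : ℝ, 0 < C ∧ ∀ (g : L2BdryVec Ω) (φ : H) (u : ℝ → H),
      IsRieszRep Ω ι g φ → (∀ α : ℝ, 0 < α → IsMinimiser Ω ι g α (u α)) →
      (∀ α : ℝ, 0 < α →
        (holoSubspace Ω ι).starProjection (u α) = (holoSubspace Ω ι).starProjection φ) ∧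
      (∀ α : ℝ, 0 < α →
        ‖(holoSubspace Ω ι)ᗮ.starProjection (u α)‖ ≤ ‖(holoSubspace Ω ι)ᗮ.starProjection φ‖ ∧
        ‖(holoSubspace Ω ι)ᗮ.starProjection φ‖ ≤ C * ‖g‖) ∧
      (∀ α : ℝ, 0 < α → ∀ v ∈ (holoSubspace Ω ι)ᗮ,
        inner ℝ (crOp Ω (ι ((holoSubspace Ω ι)ᗮ.starProjection (u α)))) (crOp Ω (ι v))
            + α * inner ℝ ((holoSubspace Ω ι)ᗮ.starProjection (u α)) v
          = α * bdryFunctional Ω g (ι v)) ∧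
      (Tendsto u (𝓝[>] 0) (𝓝 ((holoSubspace Ω ι).starProjection φ)) ∧
        Tendsto (fun α : ℝ => (1 / Real.sqrt α) • crOp Ω (ι (u α))) (𝓝[>] 0) (𝓝 0)) ∧
      Tendsto u atTop (𝓝 φ) := by
  obtain ⟨T, hT⟩ := exists_bdryFunctional_eq_inner hΩo hΩb hΩL
  set A : H →L[ℝ] L2Vec Ω := crOp Ω ∘L ι with hA
  set S : H →L[ℝ] L2BdryVec Ω := T ∘L ι with hS
  -- the Riesz representative of the boundary functional of `g` is `S† g`
  have hriesz : ∀ g, IsRieszRep Ω ι g (ContinuousLinearMap.adjoint S g) := by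
    intro g v
    rw [ContinuousLinearMap.adjoint_inner_left, hT]
    rfl
  have hriesz_unique : ∀ g φ, IsRieszRep Ω ι g φ → φ = ContinuousLinearMap.adjoint S g :=
    fun g φ hφ => ext_inner_right ℝ fun v => (hφ v).trans (hriesz g v).symm
  have hmin : ∀ g φ, IsRieszRep Ω ι g φ → ∀ α : ℝ, 0 < α → ∀ u,
      IsMinimiser Ω ι g α u ↔ IsTikhonovSolution A φ α u := by
    intro g φ hφ α hα u
    rw [← isTikhonovSolution_iff_minimises A φ hα u]
    refine forall_congr' fun v => ?_
    rw [penalised, penalised, ← hφ u, ← hφ v]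
    rfl
  refine ⟨fun g => ⟨⟨_, hriesz g, hriesz_unique g⟩, fun α hα => ?_⟩,
    ‖ContinuousLinearMap.adjoint S‖ + 1, by positivity, fun g φ u hφ hu => ?_⟩
  · obtain ⟨u, hu⟩ := exists_isTikhonovSolution A (ContinuousLinearMap.adjoint S g) hα
    exact ⟨u, (hmin g _ (hriesz g) α hα u).2 hu, fun w hw =>
      ((hmin g _ (hriesz g) α hα w).1 hw).unique hα hu⟩
  have hsol : ∀ α : ℝ, 0 < α → IsTikhonovSolution A φ α (u α) := fun α hα =>
    (hmin g φ hφ α hα (u α)).1 (hu α hα)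
  have hV1 : ∀ α : ℝ, 0 < α →
      (holoSubspace Ω ι).starProjection (u α) = (holoSubspace Ω ι).starProjection φ :=
    fun α hα => (hsol α hα).starProjection_ker_eq hα
  have hsol2 : ∀ α : ℝ, 0 < α → IsTikhonovSolution A ((holoSubspace Ω ι)ᗮ.starProjection φ) α
      ((holoSubspace Ω ι)ᗮ.starProjection (u α)) :=
    fun α hα => (hsol α hα).starProjection_orthogonal hα
  have hdecomp : ∀ x : H, (holoSubspace Ω ι).starProjection x
      + (holoSubspace Ω ι)ᗮ.starProjection x = x := fun x => by
    rw [Submodule.starProjection_orthogonal_val, add_sub_cancel]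
  have hAV : ∀ x : H, A ((holoSubspace Ω ι)ᗮ.starProjection x) = A x := fun x => by
    have h1 : A ((holoSubspace Ω ι).starProjection x) = 0 :=
      Submodule.starProjection_apply_mem (holoSubspace Ω ι) x
    rw [Submodule.starProjection_orthogonal_val, map_sub, h1, sub_zero]
  refine ⟨hV1, fun α hα => ⟨(hsol2 α hα).norm_le hα, ?_⟩, fun α hα v hv => ?_, ?_, ?_⟩
  · refine ((holoSubspace Ω ι)ᗮ.norm_starProjection_apply_le φ).trans ?_
    rw [hriesz_unique g φ hφ]
    refine (ContinuousLinearMap.le_opNorm _ g).trans ?_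
    gcongr
    linarith
  · have h1 : inner ℝ ((holoSubspace Ω ι)ᗮ.starProjection φ) v = inner ℝ φ v := by
      rw [Submodule.inner_starProjection_left_eq_right, Submodule.starProjection_eq_self_iff.2 hv]
    rw [← hφ v, ← h1]
    exact hsol2 α hα v
  · obtain ⟨h1, h2⟩ := IsTikhonovSolution.tendsto_zero
      (u := fun α => (holoSubspace Ω ι)ᗮ.starProjection (u α))
      (Submodule.starProjection_apply_mem (holoSubspace Ω ι)ᗮ φ) hsol2
    constructor
    · have h3 := h1.const_add ((holoSubspace Ω ι).starProjection φ)
      rw [add_zero] at h3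
      refine h3.congr' ?_
      filter_upwards [self_mem_nhdsWithin] with α hα
      rw [← hV1 α hα, hdecomp]
    · refine h2.congr fun α => ?_
      rw [hAV]
      rfl
  · rw [tendsto_iff_norm_sub_tendsto_zero]
    have h1 : Tendsto (fun α : ℝ => ‖A‖ ^ 2 * ‖φ‖ / α) atTop (𝓝 0) :=
      tendsto_const_nhds.div_atTop tendsto_id
    refine squeeze_zero' (Eventually.of_forall fun α => norm_nonneg _) ?_ h1
    filter_upwards [eventually_gt_atTop 0] with α hα using (hsol α hα).norm_sub_le hα
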